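/- Let $n\ge 1$, $0\le r_0<\bar r\le+\infty$, and let $\phi:[r_0,\bar r)\to\mathbb{R}$ be smooth with $\phi'>0$ on $[r_0,\bar r)$ and $\phi(r)>0$ for all $r\in[r_0,\bar r)$ with $r>0$ (so $\phi$ may vanish at $r=0$ if $r_0=0$). Let $\mathbf N^{n+1}=[r_0,\bar r)\times\mathbb S^n$ carry the warped product metric $\bar g=dr^2+\phi(r)^2\sigma$, where $\sigma$ is the round metric on the unit sphere $\mathbb S^n$, and let $dv$ be its volume element. Let $T\in(0,+\infty]$ and let $X:\mathbb S^n\times[0,T)\to\mathbf N^{n+1}$ be a smooth family of smooth embeddings, with images $M_t=X(\mathbb S^n,t)$, that solves $$\frac{\partial X}{\partial t}(x,t)=\Big(n-\frac{uH}{\phi'}\Big)\nu(x,t),$$ where $\nu$ is the unit outer normal of $M_t$, $H$ is the mean curvature of $M_t$ (the trace of the second fundamental form $h(Y,Z)=\bar g(\bar\nabla_Y\nu,Z)$) and $u=\bar g(\phi\,\partial_r,\nu)$ is the support function. Suppose that the solution is graphical: $M_t=\{(r(\theta,t),\theta):\theta\in\mathbb S^n\}$ for every $t\in[0,T)$, with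 a positive function $r$ that is smooth on $\mathbb S^n\times[0,T)$. Let $\Omega_t=\{(\rho,\theta): r_0\le\rho\le r(\theta,t)\}$ be the domain enclosed by $M_t$ and the slice $S(r_0)=\{r_0\}\times\mathbb S^n$, and for $\alpha\in\mathbb R$ put $$V_\phi^\alpha(\Omega_t)=\int_{\Omega_t}(\phi')^\alpha\,dv,\qquad V_\phi=V_\phi^1 .$$ These integrals are finite, and the following hold. (i) $V_\phi(\Omega_t)$ is constant on $[0,T)$. (ii) Let $\alpha\in\mathbb R$ with $\phi''(r)(\alpha-1)<0$ for all $r\in[r_0,\bar r)$ with $r>0$. Then $V_\phi^\alpha(\Omega_s)\le V_\phi^\alpha(\Omega_t)$ for all $0\le s<t<T$, and the inequality is strict unless $M_\tau$ is a slice $\{\rho\}\times\mathbb S^n$ for every $\tau\in[s,t]$. (iii) Let $\alpha\in\mathbb R$ with $\phi''(r)(\alpha-1)>0$ for all $r\in[r_0,\bar r)$ with $r>0$. Then $V_\phi^\alpha(\Omega_s)\ge V_\phi^\alpha(\Omega_t)$ for all $0\le s<t<T$, and the inequality is strict unless $M_\tau$ is a slice $\{\rho\}\times\mathbb S^n$ for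 every $\tau\in[s,t]$. -/

import Mathlib

open Set MeasureTheory
open scoped Manifold ContDiff Topology

noncomputable section

namespace WarpedFlow

/-- Euclidean space `ℝ^{n+1}`. -/
abbrev E (n : ℕ) : Type := EuclideanSpace ℝ (Fin (n + 1))

/-- The unit sphere `𝕊ⁿ ⊂ ℝ^{n+1}`, with the manifold structure of Mathlib. -/
abbrev S (n : ℕ) : Type := Metric.sphere (0 : E n) 1

/-- The radial interval `[r₀, r̄)`, where `r̄` may be `+∞`. -/
def radialInterval (r₀ : ℝ) (rbar : EReal) : Set ℝ := {r | r₀ ≤ r ∧ (r : EReal) < rbar}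

/-- The time interval `[0, T)`, where `T` may be `+∞`. -/
def timeInterval (T : EReal) : Set ℝ := {t | 0 ≤ t ∧ (t : EReal) < T}

/-- `φ'` on `I = [r₀, r̄)`, one-sided at the endpoint `r₀`. -/
def d1 (φ : ℝ → ℝ) (I : Set ℝ) : ℝ → ℝ := derivWithin φ I

/-- `φ''` on `I = [r₀, r̄)`, one-sided at the endpoint `r₀`. -/
def d2 (φ : ℝ → ℝ) (I : Set ℝ) : ℝ → ℝ := derivWithin (derivWithin φ I) I

/-- `φ` is the warping function of a rotationally symmetric space
`N^{n+1} = [r₀, r̄) × 𝕊ⁿ` with metric `dr² + φ(r)² σ`. If `r₀ = 0`, then `φ` may vanish at `r = 0`,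
as for the space forms in geodesic polar coordinates. -/
structure IsWarping (φ : ℝ → ℝ) (r₀ : ℝ) (rbar : EReal) : Prop where
  r₀_nonneg : 0 ≤ r₀
  smooth : ContDiffOn ℝ ∞ φ (radialInterval r₀ rbar)
  pos : ∀ r ∈ radialInterval r₀ rbar, 0 < r → 0 < φ r
  d1_pos : ∀ r ∈ radialInterval r₀ rbar, 0 < d1 φ (radialInterval r₀ rbar) r

/-- The inclusion `ℝ × 𝕊ⁿ ⊂ ℝ × ℝ^{n+1}`. Tangent vectors of `N` at `(r, θ)` are the pairs
`(a, v) ∈ ℝ × ℝ^{n+1}` with `v ⟂ θ`; the pair `(a, v)` is `a ∂_r + v`. -/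
def incl {n : ℕ} (p : ℝ × S n) : ℝ × E n := (p.1, (p.2 : E n))

/-- The warped product metric `ḡ = dr² + φ² σ` at a point of radius `r`. The same formula is the
metric of `I ×_φ ℝ^{n+1}`, of which `N` is a Riemannian submanifold. -/
def metric {n : ℕ} (φ : ℝ → ℝ) (r : ℝ) (v w : ℝ × E n) : ℝ :=
  v.1 * w.1 + φ r ^ 2 * inner ℝ v.2 w.2

/-- The Christoffel symbols of `dr² + φ² ⟨·,·⟩` on `I × ℝ^{n+1}`:
`∇̄_v w = D_v w + christoffel v w`. -/
def christoffel {n : ℕ} (φ : ℝ → ℝ) (I : Set ℝ) (r : ℝ) (v w : ℝ × E n) : ℝ × E n :=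
  (-(φ r * d1 φ I r * inner ℝ v.2 w.2), (d1 φ I r / φ r) • (v.1 • w.2 + w.1 • v.2))

/-- The connection given by `christoffel` is torsion-free. -/
theorem christoffel_symm {n : ℕ} (φ : ℝ → ℝ) (I : Set ℝ) (r : ℝ) (v w : ℝ × E n) :
    christoffel φ I r v w = christoffel φ I r w v := by
  simp only [christoffel, real_inner_comm, add_comm]

/-- The connection given by `christoffel` is compatible with the metric. Together with
`christoffel_symm` this says that it is the Levi-Civita connection. -/
theorem christoffel_metric {n : ℕ} (φ : ℝ → ℝ) (I : Set ℝ) (r : ℝ) (hφ : φ r ≠ 0)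
    (hd : DifferentiableWithinAt ℝ φ I r) (v a b : ℝ × E n) :
    HasDerivWithinAt (fun s => v.1 * metric φ s a b)
      (metric φ r (christoffel φ I r v a) b + metric φ r a (christoffel φ I r v b)) I r := by
  have h := (((hd.hasDerivWithinAt.pow 2).mul_const (inner ℝ a.2 b.2)).const_add
    (a.1 * b.1)).const_mul v.1
  refine h.congr_deriv ?_
  simp only [metric, christoffel, d1, inner_smul_left, inner_smul_right, inner_add_left,
    inner_add_right, real_inner_comm]
  rw [real_inner_comm a.2 v.2]
  simp
  field_simp
  ring

variable {n : ℕ}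

/-- The differential `dY_x : T_x 𝕊ⁿ → T N` of a map `Y : 𝕊ⁿ → N`. -/
def diff (Y : S n → ℝ × S n) (x : S n) : TangentSpace (𝓡 n) x →L[ℝ] ℝ × E n :=
  mvfderiv (𝓡 n) (fun y => incl (Y y)) x

/-- `Y : 𝕊ⁿ → N` is a smooth embedding into `[r₀, r̄) × 𝕊ⁿ`: a smooth injective immersion
(of a compact manifold). -/
structure IsEmb (r₀ : ℝ) (rbar : EReal) (Y : S n → ℝ × S n) : Prop where
  smooth : ContMDiff (𝓡 n) (𝓘(ℝ, ℝ).prod (𝓡 n)) ∞ Y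
  mem : ∀ x, (Y x).1 ∈ radialInterval r₀ rbar
  inj : Function.Injective Y
  immersion : ∀ x, Function.Injective (diff Y x)

/-- The induced metric `g_x(ξ, η) = ḡ(dY ξ, dY η)`. -/
def indMetric (φ : ℝ → ℝ) (Y : S n → ℝ × S n) (x : S n) (ξ η : TangentSpace (𝓡 n) x) : ℝ :=
  metric φ (Y x).1 (diff Y x ξ) (diff Y x η)

/-- `∇̄_ξ ν`, the covariant derivative of a vector field `ν` along `Y`, taken in `I ×_φ ℝ^{n+1}`. Its
component tangent to `N` is the covariant derivative in `N`. -/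
def covDeriv (φ : ℝ → ℝ) (I : Set ℝ) (Y : S n → ℝ × S n) (ν : S n → ℝ × E n) (x : S n)
    (ξ : TangentSpace (𝓡 n) x) : ℝ × E n :=
  mvfderiv (𝓡 n) ν x ξ + christoffel φ I (Y x).1 (diff Y x ξ) (ν x)

/-- The second fundamental form `h(ξ, η) = ḡ(∇̄_ξ ν, dY η)`; slices with `ν = ∂_r` have
`h = (φ'/φ) g`. -/
def secondFF (φ : ℝ → ℝ) (I : Set ℝ) (Y : S n → ℝ × S n) (ν : S n → ℝ × E n) (x : S n)
    (ξ η : TangentSpace (𝓡 n) x) : ℝ :=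
  metric φ (Y x).1 (covDeriv φ I Y ν x ξ) (diff Y x η)

/-- A basis `e₁, …, eₙ` of `T_x 𝕊ⁿ`. -/
def frame (x : S n) (i : Fin n) : TangentSpace (𝓡 n) x :=
  (EuclideanSpace.single i (1 : ℝ) : EuclideanSpace ℝ (Fin n))

/-- The mean curvature `H = g^{ij} h_{ij}`. -/
def meanCurvature (φ : ℝ → ℝ) (I : Set ℝ) (Y : S n → ℝ × S n) (ν : S n → ℝ × E n) (x : S n) : ℝ :=
  Matrix.trace
    ((Matrix.of fun i j => indMetric φ Y x (frame x i) (frame x j))⁻¹ *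
      Matrix.of fun i j => secondFF φ I Y ν x (frame x i) (frame x j))

/-- The support function `u = ḡ(φ ∂_r, ν)`. -/
def support (φ : ℝ → ℝ) (Y : S n → ℝ × S n) (ν : S n → ℝ × E n) (x : S n) : ℝ :=
  metric φ (Y x).1 (φ (Y x).1, 0) (ν x)

/-- `ν` is the unit outer normal of the graphical hypersurface parametrized by `Y`: tangent to `N`,
orthogonal to the hypersurface, of length one, and pointing out of the domain below the graph. -/
structure IsOuterNormal (φ : ℝ → ℝ) (Y : S n → ℝ × S n) (ν : S n → ℝ × E n) : Prop where
  tangent : ∀ x, inner ℝ (ν x).2 ((Y x).2 : E n) = 0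
  normal : ∀ x ξ, metric φ (Y x).1 (ν x) (diff Y x ξ) = 0
  unit : ∀ x, metric φ (Y x).1 (ν x) (ν x) = 1
  outer : ∀ x, 0 < metric φ (Y x).1 (ν x) (1, 0)

/-- The graph `{(r(θ), θ)}` of a function on the sphere. -/
def graph (r : S n → ℝ) : Set (ℝ × S n) := {p | p.1 = r p.2}

/-- The domain enclosed by the graph of `r` and the slice `S(r₀)`. -/
def enclosed (r₀ : ℝ) (r : S n → ℝ) : Set (ℝ × S n) := {p | r₀ ≤ p.1 ∧ p.1 ≤ r p.2}

/-- `M` is a slice `S(ρ) = {ρ} × 𝕊ⁿ`. -/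
def IsSlice (M : Set (ℝ × S n)) : Prop := ∃ ρ : ℝ, M = {ρ} ×ˢ univ

/-- `X : 𝕊ⁿ × [0, T) → N` is a smooth graphical solution of `∂_t X = (n - u H / φ') ν`: a smooth
family of embeddings with unit outer normal `ν(·, t)`, satisfying the equation, whose image `M_t` is
the graph of `r(·, t)`, a smooth family of smooth positive functions. -/
structure IsGraphicalSolution (φ : ℝ → ℝ) (r₀ : ℝ) (rbar T : EReal)
    (X : ℝ → S n → ℝ × S n) (ν : ℝ → S n → ℝ × E n) (r : ℝ → S n → ℝ) : Prop where
  smooth : ContMDiffOn ((𝓡 n).prod 𝓘(ℝ, ℝ)) (𝓘(ℝ, ℝ).prod (𝓡 n)) ∞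
    (fun p : S n × ℝ => X p.2 p.1) (univ ×ˢ timeInterval T)
  emb : ∀ t ∈ timeInterval T, IsEmb r₀ rbar (X t)
  normal : ∀ t ∈ timeInterval T, IsOuterNormal φ (X t) (ν t)
  flow : ∀ t ∈ timeInterval T, ∀ x : S n,
    HasDerivWithinAt (fun s => incl (X s x))
      (((n : ℝ) - support φ (X t) (ν t) x *
          meanCurvature φ (radialInterval r₀ rbar) (X t) (ν t) x /
          d1 φ (radialInterval r₀ rbar) (X t x).1) • ν t x)
      (timeInterval T) t
  graph_smooth : ContMDiffOn ((𝓡 n).prod 𝓘(ℝ, ℝ)) 𝓘(ℝ, ℝ) ∞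
    (fun p : S n × ℝ => r p.2 p.1) (univ ×ˢ timeInterval T)
  graph_pos : ∀ t ∈ timeInterval T, ∀ θ, 0 < r t θ
  graph_eq : ∀ t ∈ timeInterval T, range (X t) = graph (r t)

/-- The Riemannian volume `dv = φ(r)ⁿ dr dσ` of `N = [r₀, r̄) × 𝕊ⁿ`, where `dσ` is the surface
measure of the unit sphere. -/
def volN (n : ℕ) (φ : ℝ → ℝ) (I : Set ℝ) : Measure (ℝ × S n) :=
  ((volume.restrict I).withDensity fun r => ENNReal.ofReal (φ r ^ n)).prod
    (volume : Measure (E n)).toSphere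

/-- The weighted `α`-volume `V_φ^α(Ω) = ∫_Ω (φ')^α dv`. -/
def weightedVolume (φ : ℝ → ℝ) (I : Set ℝ) (α : ℝ) (Ω : Set (ℝ × S n)) : ℝ :=
  ∫ p in Ω, d1 φ I p.1 ^ α ∂(volN n φ I)

/-- The integral that defines the weighted `α`-volume converges. -/
def HasWeightedVolume (φ : ℝ → ℝ) (I : Set ℝ) (α : ℝ) (Ω : Set (ℝ × S n)) : Prop :=
  IntegrableOn (fun p : ℝ × S n => d1 φ I p.1 ^ α) Ω (volN n φ I)

end WarpedFlow

end

noncomputable section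

namespace WarpedFlow

variable {n : ℕ}

/-! ### Radial projection to the sphere -/

/-! Write $v=\sqrt{1+|\nabla r|^2/\varphi^2}$ and $N=-\nabla r/(\varphi^2 v)$, so that the outer
normal of the graph is $(1/v,N)$ and $\langle\nabla r,N\rangle=-(v^2-1)/v$. The mean curvature is
$H=\operatorname{div}N+\frac{\varphi'}{\varphi}(\langle\nabla r,N\rangle+n/v)$ (`meanCurvature_eq`),
and a normal speed $f$ moves the radius over a fixed direction with speed $fv$ (`speed_eq`). Since
$u=\varphi/v$, the flow becomes $$\partial_t
r=(n+1)\frac{v^2-1}{v}-\frac{\varphi}{\varphi'}\operatorname{div}N$$ (`hasDerivAt_radius`).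

By Fubini the weighted volume is the integral over the sphere of a primitive of
$(\varphi')^\alpha\varphi^n$, evaluated at $r$. In its time derivative, integrate
$(\varphi')^{\alpha-1}\varphi^{n+1}\operatorname{div}N$ by parts. Differentiating $\varphi^{n+1}$
cancels the first term of $\partial_t r$; differentiating $(\varphi')^{\alpha-1}$ leaves
$$\frac{d}{dt}V_\varphi^\alpha=-(\alpha-1)\int\varphi''(\varphi')^{\alpha-2}\varphi^{n+1}\frac{v^2-1}{v}\,d\sigma$$
(`integral_density_mul`, `hasDerivAt_weightedVolume`). This vanishes for $\alpha=1$ and otherwise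
has the sign of $-\varphi''(\alpha-1)$. If the two volumes agree, then $v=1$ at all intermediate
times, so $r$ is constant on the sphere; continuity covers the end times.

Calculus on the sphere is done in $\mathbb R^{n+1}\setminus\{0\}$ with extensions that are constant
along rays. At such an extension of a tangential field the Euclidean divergence on the unit sphere
serves as the spherical one. -/

theorem inv_norm_smul_mem_sphere {y : E n} (hy : y ≠ 0) :
    ‖y‖⁻¹ • y ∈ Metric.sphere (0 : E n) 1 := by
  simp [norm_smul, hy]

open Classical in
/-- The radial projection `y ↦ y / |y|` of `ℝ^{n+1} ∖ {0}` to the unit sphere. -/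
def proj (y : E n) : S n :=
  -- The value at the origin is arbitrary; with it `proj_smul` holds for every vector.
  if hy : y = 0 then ⟨EuclideanSpace.single 0 1, by simp⟩
  else ⟨‖y‖⁻¹ • y, inv_norm_smul_mem_sphere hy⟩

theorem coe_proj {y : E n} (hy : y ≠ 0) : (proj y : E n) = ‖y‖⁻¹ • y := by
  simp [proj, hy]

theorem proj_coe (θ : S n) : proj (θ : E n) = θ := by
  have h : (θ : E n) ≠ 0 := ne_zero_of_mem_unit_sphere θ
  ext1
  rw [coe_proj h]
  simp

theorem proj_smul {c : ℝ} (hc : 0 < c) (y : E n) : proj (c • y) = proj y := by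
  by_cases hy : y = 0
  · simp [hy]
  have hcy : c • y ≠ 0 := smul_ne_zero hc.ne' hy
  ext1
  rw [coe_proj hy, coe_proj hcy, norm_smul, smul_smul, Real.norm_of_nonneg hc.le]
  congr 1
  field_simp

theorem norm_smul_proj (y : E n) : ‖y‖ • (proj y : E n) = y := by
  by_cases hy : y = 0
  · simp [hy]
  · rw [coe_proj hy, smul_smul, mul_inv_cancel₀ (norm_ne_zero_iff.2 hy), one_smul]

/-- On the open submanifold of nonzero vectors the map $y/|y|$ is smooth into $\mathbb R^{n+1}$, and
a smooth map with values in the sphere stays smooth after restricting its codomain. -/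
theorem contMDiffAt_proj {y : E n} (hy : y ≠ 0) : ContMDiffAt 𝓘(ℝ, E n) (𝓡 n) ∞ proj y := by
  have : Fact (Module.finrank ℝ (E n) = n + 1) := ⟨finrank_euclideanSpace_fin⟩
  let U : TopologicalSpace.Opens (E n) := ⟨{0}ᶜ, isOpen_compl_singleton⟩
  have hU : ∀ z : U, (z : E n) ≠ 0 := fun z => z.2
  have h1 : ContMDiff 𝓘(ℝ, E n) 𝓘(ℝ, E n) ∞ (fun z : U => ‖(z : E n)‖⁻¹ • (z : E n)) := by
    intro z
    refine (contMDiffAt_subtype_iff (f := fun z : E n => ‖z‖⁻¹ • z)).2 (ContDiffAt.contMDiffAt ?_)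
    exact ((contDiffAt_norm ℝ (hU z)).inv (norm_ne_zero_iff.2 (hU z))).smul contDiffAt_id
  have h2 := h1.codRestrict_sphere (n := n) (fun z => inv_norm_smul_mem_sphere (hU z))
  refine (contMDiffAt_subtype_iff (U := U) (x := ⟨y, hy⟩)).1 ?_
  refine (h2 ⟨y, hy⟩).congr_of_eventuallyEq (Filter.Eventually.of_forall fun z => ?_)
  ext1
  exact coe_proj (hU z)

/-! ### Functions that are constant along rays -/

/-- `f` is homogeneous of degree zero: constant along the rays from the origin. -/
def HomogZero {F : Type*} (f : E n → F) : Prop := ∀ y, ∀ c : ℝ, 0 < c → f (c • y) = f y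

theorem homogZero_comp_proj {F : Type*} (g : S n → F) : HomogZero fun y => g (proj y) :=
  fun y c hc => by simp only [proj_smul hc]

theorem HomogZero.proj_eq {F : Type*} {f : E n → F} (hf : HomogZero f) {y : E n} (hy : y ≠ 0) :
    f (proj y) = f y := by
  rw [coe_proj hy]
  exact hf y _ (inv_pos.2 (norm_pos_iff.2 hy))

section Homog

variable {F : Type*} [NormedAddCommGroup F] [NormedSpace ℝ F] {f : E n → F}

theorem HomogZero.fderiv_smul (hf : HomogZero f) {c : ℝ} (hc : 0 < c) (y : E n) :
    fderiv ℝ f (c • y) = c⁻¹ • fderiv ℝ f y := by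
  have h := fderiv_comp_smul (𝕜 := ℝ) (f := f) (x := y) c
  have hfc : (fun x => f (c • x)) = f := funext fun x => hf x c hc
  rw [hfc] at h
  rw [h, smul_smul, inv_mul_cancel₀ hc.ne', one_smul]

/-- Euler's identity in degree zero: differentiate the constant function $c\mapsto f(cy)$ at $c=1$.
-/
theorem HomogZero.fderiv_self (hf : HomogZero f) {y : E n} (hd : DifferentiableAt ℝ f y) :
    fderiv ℝ f y y = 0 := by
  have h1 : HasDerivAt (fun c : ℝ => c • y) y 1 := by
    simpa using (hasDerivAt_id (1 : ℝ)).smul_const y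
  have h2 : HasDerivAt (fun c : ℝ => f (c • y)) (fderiv ℝ f y y) 1 := by
    have := hd.hasFDerivAt
    rw [← one_smul ℝ y] at this
    have h3 := this.comp_hasDerivAt (1 : ℝ) h1
    simpa [Function.comp_def] using h3
  have h4 : HasDerivAt (fun c : ℝ => f (c • y)) 0 1 := by
    refine (hasDerivAt_const (1 : ℝ) (f y)).congr_of_eventuallyEq ?_
    filter_upwards [lt_mem_nhds (zero_lt_one' ℝ)] with c hc using hf y c hc
  exact h2.unique h4

end Homog

/-! ### The divergence theorem on the sphere -/

/-- The divergence of a vector field on `ℝ^{n+1}`. -/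
def divg (W : E n → E n) (y : E n) : ℝ := LinearMap.trace ℝ (E n) (fderiv ℝ W y).toLinearMap

theorem divg_eq_sum (W : E n → E n) (y : E n) :
    divg W y = ∑ i, inner ℝ (EuclideanSpace.basisFun (Fin (n + 1)) ℝ i)
      (fderiv ℝ W y (EuclideanSpace.basisFun (Fin (n + 1)) ℝ i)) :=
  LinearMap.trace_eq_sum_inner _ _

theorem divg_smul {c : E n → ℝ} {W : E n → E n} {y : E n} (hc : DifferentiableAt ℝ c y)
    (hW : DifferentiableAt ℝ W y) :
    divg (fun y => c y • W y) y = c y * divg W y + fderiv ℝ c y (W y) := by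
  have h : (fderiv ℝ (fun y => c y • W y) y).toLinearMap =
      c y • (fderiv ℝ W y).toLinearMap + (fderiv ℝ c y).toLinearMap.smulRight (W y) := by
    rw [fderiv_fun_smul hc hW]
    rfl
  rw [divg, h, map_add, map_smul, LinearMap.trace_smulRight]
  rfl

/-- Each directional derivative of a compactly supported field integrates to zero, by integration by
parts against the constant function 1. -/
theorem integral_divg_eq_zero {W : E n → E n} (hW : ContDiff ℝ 1 W) (hc : HasCompactSupport W) :
    ∫ y, divg W y = 0 := by
  have hcont : ∀ v, Continuous fun y => fderiv ℝ W y v := fun v =>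
    (hW.continuous_fderiv one_ne_zero).clm_apply continuous_const
  have hint : ∀ v, Integrable fun y => fderiv ℝ W y v := fun v =>
    (hcont v).integrable_of_hasCompactSupport (hc.fderiv_apply (𝕜 := ℝ) v)
  have hz : ∀ v, ∫ y, fderiv ℝ W y v = 0 := by
    intro v
    have h := integral_smul_fderiv_eq_neg_fderiv_smul_of_integrable (μ := (volume : Measure (E n)))
      (𝕜 := ℝ) (f := fun _ : E n => (1 : ℝ)) (g := W) (v := v) (by simp) (by simpa using hint v)
      (by simpa using hW.continuous.integrable_of_hasCompactSupport hc) (by simp)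
      (fun x _ => hW.differentiable one_ne_zero x)
    simpa using h
  simp_rw [divg_eq_sum]
  rw [integral_finsetSum _ fun i _ => (hint _).const_inner _]
  exact Finset.sum_eq_zero fun i _ => by rw [integral_inner (hint _), hz, inner_zero_right]

theorem integral_eq_integral_sphere_prod (f : E n → ℝ) :
    ∫ y, f y = ∫ p : S n × Ioi (0 : ℝ), f ((p.2 : ℝ) • (p.1 : E n))
      ∂((volume : Measure (E n)).toSphere.prod (Measure.volumeIoiPow n)) := by
  have h := (Measure.measurePreserving_homeomorphUnitSphereProd (volume : Measure (E n)))
  have hd : Module.finrank ℝ (E n) - 1 = n := by simp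
  rw [hd] at h
  rw [← h.integral_comp (Homeomorph.measurableEmbedding _)]
  have h0 : ∫ y, f y = ∫ y in ({0}ᶜ : Set (E n)), f y := by
    rw [restrict_compl_singleton]
  rw [h0, ← integral_subtype_comap (measurableSet_singleton _).compl]
  refine integral_congr_ae (Filter.Eventually.of_forall fun y => ?_)
  have : ((homeomorphUnitSphereProd (E n) y).2 : ℝ) • ((homeomorphUnitSphereProd (E n) y).1 : E n)
      = y := by
    rw [← homeomorphUnitSphereProd_symm_apply_coe, Homeomorph.symm_apply_apply]
  simp only [this]

/-- Polar coordinates separate the variables. Degree $-1$ is the homogeneity of the divergence of a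
field that is constant along rays. -/
theorem integral_radial_mul (χ : ℝ → ℝ) (d : E n → ℝ)
    (hd : ∀ y, ∀ c : ℝ, 0 < c → d (c • y) = c⁻¹ * d y) :
    ∫ y, χ ‖y‖ * d y = (∫ θ : S n, d θ ∂(volume : Measure (E n)).toSphere) *
      ∫ s : Ioi (0 : ℝ), χ s * (s : ℝ)⁻¹ ∂Measure.volumeIoiPow n := by
  rw [integral_eq_integral_sphere_prod, ← integral_prod_mul]
  refine integral_congr_ae (Filter.Eventually.of_forall fun p => ?_)
  have hp : (0 : ℝ) < p.2 := p.2.2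
  simp only
  rw [hd _ _ hp, norm_smul, Real.norm_of_nonneg hp.le, norm_eq_of_mem_sphere, mul_one]
  ring

/-- A smooth radial cutoff function, equal to one near the unit sphere. -/
def cutoff : ContDiffBump (1 : ℝ) := ⟨1 / 4, 1 / 2, by norm_num, by norm_num⟩

theorem cutoff_eq_zero {s : ℝ} (hs : s ∉ Ioo (1 / 2) (3 / 2)) : cutoff s = 0 := by
  apply cutoff.zero_of_le_dist
  rw [Real.dist_eq]
  by_contra! h
  have : |s - 1| < 1 / 2 := h
  rw [abs_lt] at this
  exact hs ⟨by linarith [this.1], by linarith [this.2]⟩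

theorem cutoff_norm_eventuallyEq_zero :
    (fun y : E n => cutoff ‖y‖) =ᶠ[𝓝 0] fun _ => 0 := by
  filter_upwards [Metric.ball_mem_nhds (0 : E n) (by norm_num : (0 : ℝ) < 1 / 2)] with y hy
  rw [mem_ball_zero_iff] at hy
  exact cutoff_eq_zero fun h => by linarith [h.1]

theorem contDiff_cutoff_norm_smul {F : Type*} [NormedAddCommGroup F] [NormedSpace ℝ F]
    {W : E n → F} (hW : ContDiffOn ℝ 1 W {0}ᶜ) :
    ContDiff ℝ 1 fun y => cutoff ‖y‖ • W y := by
  rw [contDiff_iff_contDiffAt]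
  intro y
  by_cases hy : y = 0
  · subst hy
    refine (contDiffAt_const (c := (0 : F))).congr_of_eventuallyEq ?_
    filter_upwards [cutoff_norm_eventuallyEq_zero] with y hy
    simp [hy]
  · exact (cutoff.contDiffAt.comp y (contDiffAt_norm ℝ hy)).smul
      (hW.contDiffAt (isOpen_compl_singleton.mem_nhds hy))

theorem hasCompactSupport_cutoff_norm_smul {F : Type*} [NormedAddCommGroup F] [NormedSpace ℝ F]
    (W : E n → F) : HasCompactSupport fun y => cutoff ‖y‖ • W y := by
  refine HasCompactSupport.intro (isCompact_closedBall (0 : E n) (3 / 2)) fun y hy => ?_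
  rw [mem_closedBall_zero_iff, not_le] at hy
  rw [cutoff_eq_zero fun h => by linarith [h.2], zero_smul]

/-- The polar formula for $|y|^{-1}$, which has degree $-1$, exhibits this number as a factor of a
positive integral. -/
theorem integral_cutoff_ne_zero :
    ∫ s : Ioi (0 : ℝ), cutoff s * (s : ℝ)⁻¹ ∂Measure.volumeIoiPow n ≠ 0 := by
  have hd : ∀ y : E n, ∀ c : ℝ, 0 < c → ‖c • y‖⁻¹ = c⁻¹ * ‖y‖⁻¹ := fun y c hc => by
    rw [norm_smul, Real.norm_of_nonneg hc.le, mul_inv]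
  have h := integral_radial_mul (cutoff : ℝ → ℝ) (fun y : E n => ‖y‖⁻¹) hd
  have hsm : ContDiffOn ℝ 1 (fun y : E n => ‖y‖⁻¹) {0}ᶜ := fun y hy =>
    ((contDiffAt_norm ℝ hy).inv (norm_ne_zero_iff.2 hy)).contDiffWithinAt
  have hpos : 0 < ∫ y : E n, cutoff ‖y‖ * ‖y‖⁻¹ := by
    refine (contDiff_cutoff_norm_smul hsm).continuous.integral_pos_of_hasCompactSupport_nonneg_nonzero
      (hasCompactSupport_cutoff_norm_smul _) (fun y => ?_) (x := EuclideanSpace.single 0 1) ?_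
    · exact mul_nonneg cutoff.nonneg (inv_nonneg.2 (norm_nonneg _))
    · have : (cutoff : ℝ → ℝ) 1 = 1 := cutoff.one_of_mem_closedBall (by simp [cutoff.rIn_pos.le])
      simp [this]
  intro h0
  rw [h, h0, mul_zero] at hpos
  exact lt_irrefl _ hpos

/-- The divergence theorem on the unit sphere, for tangential fields extended to be constant along
rays. -/
theorem integral_sphere_divg_eq_zero {W : E n → E n} (hW : ContDiffOn ℝ 1 W {0}ᶜ)
    (hom : HomogZero W) (htan : ∀ y, inner ℝ y (W y) = 0) :
    ∫ θ : S n, divg W θ ∂(volume : Measure (E n)).toSphere = 0 := by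
  have h0 := integral_divg_eq_zero (contDiff_cutoff_norm_smul hW)
    (hasCompactSupport_cutoff_norm_smul W)
  -- The gradient of the cutoff is radial and the field is tangential, so the product rule has no
  -- cross term.
  have hdiv : ∀ y, divg (fun y => cutoff ‖y‖ • W y) y = cutoff ‖y‖ * divg W y := by
    intro y
    by_cases hy : y = 0
    · subst hy
      have h1 : (fun y : E n => cutoff ‖y‖ • W y) =ᶠ[𝓝 0] fun _ => 0 := by
        filter_upwards [cutoff_norm_eventuallyEq_zero] with y hy
        simp [hy]
      rw [cutoff_norm_eventuallyEq_zero.eq_of_nhds, zero_mul, divg, h1.fderiv_eq]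
      simp
    · have hn : HasFDerivAt (fun y : E n => ‖y‖) (fderiv ℝ (fun y : E n => ‖y‖) y) y :=
        ((contDiffAt_norm ℝ hy (n := 1)).differentiableAt one_ne_zero).hasFDerivAt
      have hcut : HasDerivAt (cutoff : ℝ → ℝ) (deriv cutoff ‖y‖) ‖y‖ :=
        ((cutoff.contDiff (n := 1)).differentiable one_ne_zero _).hasDerivAt
      have hc : HasFDerivAt (fun y : E n => cutoff ‖y‖) _ y := hcut.comp_hasFDerivAt y hn
      have hWy : DifferentiableAt ℝ W y :=
        (hW.contDiffAt (isOpen_compl_singleton.mem_nhds hy)).differentiableAt one_ne_zero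
      have hsq : HasFDerivAt (fun y : E n => ‖y‖ ^ 2) _ y := hn.pow 2
      have hz : fderiv ℝ (fun y : E n => ‖y‖) y (W y) = 0 := by
        have := congrArg (fun L => L (W y)) (hsq.unique (hasStrictFDerivAt_norm_sq y).hasFDerivAt)
        simpa [htan y, hy] using this
      rw [divg_smul hc.differentiableAt hWy, hc.fderiv]
      simp [hz]
  simp_rw [hdiv] at h0
  rw [integral_radial_mul (cutoff : ℝ → ℝ) (divg W)] at h0
  · exact (mul_eq_zero.1 h0).resolve_right integral_cutoff_ne_zero
  · intro y c hc
    rw [divg, hom.fderiv_smul hc, ContinuousLinearMap.toLinearMap_smul, map_smul]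
    rfl

/-! ### The trace of an endomorphism with respect to a bilinear form -/

/-- If `h(fᵢ, fⱼ) = g(S fᵢ, fⱼ)` for a basis `f` of a subspace `W` that contains the range of `S`,
and `g` is definite on `W`, then `tr (g⁻¹ h) = tr S`. -/
theorem trace_gram_inv_mul {V : Type*} [AddCommGroup V] [Module ℝ V] [FiniteDimensional ℝ V]
    (W : Submodule ℝ V) (hW : Module.finrank ℝ W = n) (f : Fin n → V)
    (hf : LinearIndependent ℝ f) (hfW : ∀ i, f i ∈ W) (S : V →ₗ[ℝ] V) (hS : ∀ v, S v ∈ W)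
    (g : V →ₗ[ℝ] V →ₗ[ℝ] ℝ) (hg : ∀ w ∈ W, g w w = 0 → w = 0) (A B : Matrix (Fin n) (Fin n) ℝ)
    (hA : ∀ i j, A i j = g (f i) (f j)) (hB : ∀ i j, B i j = g (S (f i)) (f j)) :
    Matrix.trace (A⁻¹ * B) = LinearMap.trace ℝ V S := by
  let f' : Fin n → W := fun i => ⟨f i, hfW i⟩
  have hf' : LinearIndependent ℝ f' := LinearIndependent.of_comp W.subtype hf
  let b : Module.Basis (Fin n) ℝ W := by
    refine Module.Basis.mk hf' ?_
    rw [hf'.span_eq_top_of_card_eq_finrank' (by simp [hW])]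
  have hb : ∀ i, b i = f' i := fun i => Module.Basis.mk_apply _ _ i
  let S' : W →ₗ[ℝ] W := S.restrict fun v _ => hS v
  let s := LinearMap.toMatrix b b S'
  have hs : ∀ i, S (f i) = ∑ k, s k i • f k := by
    intro i
    have h1 : S' (f' i) = ∑ k, s k i • f' k := by
      simp only [← hb]
      simp only [s, LinearMap.toMatrix_apply]
      exact (b.sum_repr (S' (b i))).symm
    simpa [f', S'] using congrArg W.subtype h1
  -- With $s$ the matrix of the endomorphism in the basis, the second Gram matrix is $s^{T}A$;
  -- cyclicity of the trace then removes $A$ once it is known to be invertible.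
  have hBA : B = s.transpose * A := by
    ext i j
    rw [hB, hs, Matrix.mul_apply]
    simp [hA]
  have hdet : IsUnit A.det := by
    rw [isUnit_iff_ne_zero]
    intro h0
    obtain ⟨c, hc, hc0⟩ := Matrix.exists_vecMul_eq_zero_iff.2 h0
    -- A null vector of the Gram matrix yields $w\in W$ with $g(w,w)=0$, against definiteness and
    -- linear independence.
    have hw : ∑ i, c i • f i = 0 := by
      refine hg _ (W.sum_mem fun i _ => W.smul_mem _ (hfW i)) ?_
      have h2 : ∀ j, ∑ i, c i * g (f i) (f j) = 0 := by
        intro j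
        have := congrFun hc0 j
        rw [Matrix.vecMul, dotProduct] at this
        simpa [hA] using this
      simp [h2]
    exact hc (funext fun i => Fintype.linearIndependent_iff.1 hf c hw i)
  rw [hBA, Matrix.trace_mul_comm, Matrix.mul_assoc, Matrix.mul_nonsing_inv _ hdet, Matrix.mul_one,
    Matrix.trace_transpose, ← LinearMap.trace_restrict_eq_of_forall_mem W S hS,
    LinearMap.trace_eq_matrix_trace ℝ b]

/-! ### The warping function along a map -/

theorem uniqueDiffOn_radialInterval (r₀ : ℝ) (rbar : EReal) :
    UniqueDiffOn ℝ (radialInterval r₀ rbar) := by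
  induction rbar with
  | bot => simp [radialInterval, uniqueDiffOn_empty]
  | top => simpa [radialInterval, Ici] using uniqueDiffOn_Ici r₀
  | coe b => simpa [radialInterval, Ico] using uniqueDiffOn_Ico r₀ b

namespace IsWarping

variable {φ : ℝ → ℝ} {r₀ : ℝ} {rbar : EReal}

theorem contDiffOn_d1 (h : IsWarping φ r₀ rbar) :
    ContDiffOn ℝ ∞ (d1 φ (radialInterval r₀ rbar)) (radialInterval r₀ rbar) :=
  h.smooth.derivWithin (uniqueDiffOn_radialInterval r₀ rbar) (by simp)

theorem contDiffOn_d2 (h : IsWarping φ r₀ rbar) :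
    ContDiffOn ℝ ∞ (d2 φ (radialInterval r₀ rbar)) (radialInterval r₀ rbar) :=
  h.contDiffOn_d1.derivWithin (uniqueDiffOn_radialInterval r₀ rbar) (by simp)

theorem hasDerivWithinAt (h : IsWarping φ r₀ rbar) {ρ : ℝ} (hρ : ρ ∈ radialInterval r₀ rbar) :
    HasDerivWithinAt φ (d1 φ (radialInterval r₀ rbar) ρ) (radialInterval r₀ rbar) ρ :=
  (h.smooth.differentiableOn (by simp) ρ hρ).hasDerivWithinAt

theorem hasDerivWithinAt_d1 (h : IsWarping φ r₀ rbar) {ρ : ℝ}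
    (hρ : ρ ∈ radialInterval r₀ rbar) :
    HasDerivWithinAt (d1 φ (radialInterval r₀ rbar)) (d2 φ (radialInterval r₀ rbar) ρ)
      (radialInterval r₀ rbar) ρ :=
  (h.contDiffOn_d1.differentiableOn (by simp) ρ hρ).hasDerivWithinAt

end IsWarping

/-! ### Radial graphs -/

/-- The function `r` extended to `ℝ^{n+1} ∖ {0}`, constant along rays. -/
def radius (r : S n → ℝ) (y : E n) : ℝ := r (proj y)

/-- The gradient of `r` on the sphere, extended to be constant along rays. -/
def slope (r : S n → ℝ) (y : E n) : E n := gradient (radius r) (proj y)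

/-- The length `√(1 + |∇r|² / φ²)` of the normal field `∂_r - φ⁻² ∇r`. -/
def tilt (φ : ℝ → ℝ) (r : S n → ℝ) (y : E n) : ℝ :=
  √(1 + ‖slope r y‖ ^ 2 / φ (radius r y) ^ 2)

/-- The radial component of the unit normal of the graph of `r`. -/
def normalRadial (φ : ℝ → ℝ) (r : S n → ℝ) (y : E n) : ℝ := (tilt φ r y)⁻¹

/-- The spherical component of the unit normal of the graph of `r`. -/
def normalSphere (φ : ℝ → ℝ) (r : S n → ℝ) (y : E n) : E n :=
  -((φ (radius r y) ^ 2 * tilt φ r y)⁻¹ • slope r y)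

/-- `r` is a smooth positive function on the sphere, with values in `[r₀, r̄)`. -/
structure IsProfile (φ : ℝ → ℝ) (r₀ : ℝ) (rbar : EReal) (r : S n → ℝ) : Prop where
  warping : IsWarping φ r₀ rbar
  smooth : ContMDiff (𝓡 n) 𝓘(ℝ, ℝ) ∞ r
  mem : ∀ θ, r θ ∈ radialInterval r₀ rbar
  pos : ∀ θ, 0 < r θ

theorem homogZero_radius (r : S n → ℝ) : HomogZero (radius r) := homogZero_comp_proj r

theorem homogZero_slope (r : S n → ℝ) : HomogZero (slope r) :=
  homogZero_comp_proj fun θ : S n => gradient (radius r) θ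

theorem homogZero_normalSphere (φ : ℝ → ℝ) (r : S n → ℝ) : HomogZero (normalSphere φ r) := by
  intro y c hc
  simp only [normalSphere, tilt, homogZero_radius r y c hc, homogZero_slope r y c hc]

theorem radius_coe (r : S n → ℝ) (θ : S n) : radius r θ = r θ := by rw [radius, proj_coe]

theorem coe_ne_zero (θ : S n) : (θ : E n) ≠ 0 := ne_zero_of_mem_unit_sphere θ

theorem compl_zero_mem_nhds (θ : S n) : ({0}ᶜ : Set (E n)) ∈ 𝓝 (θ : E n) :=
  isOpen_compl_singleton.mem_nhds (coe_ne_zero θ)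

theorem tilt_sq (φ : ℝ → ℝ) (r : S n → ℝ) (y : E n) :
    tilt φ r y ^ 2 = 1 + ‖slope r y‖ ^ 2 / φ (radius r y) ^ 2 := Real.sq_sqrt (by positivity)

theorem tilt_pos (φ : ℝ → ℝ) (r : S n → ℝ) (y : E n) : 0 < tilt φ r y :=
  Real.sqrt_pos.2 (by positivity)

namespace IsProfile

variable {φ : ℝ → ℝ} {r₀ : ℝ} {rbar : EReal} {r : S n → ℝ}

theorem contDiffOn_radius (h : IsProfile φ r₀ rbar r) : ContDiffOn ℝ ∞ (radius r) {0}ᶜ :=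
  fun _ hy => ContDiffAt.contDiffWithinAt
    (contMDiffAt_iff_contDiffAt.1 ((h.smooth _).comp _ (contMDiffAt_proj hy)))

theorem contDiffOn_slope (h : IsProfile φ r₀ rbar r) : ContDiffOn ℝ ∞ (slope r) {0}ᶜ := by
  have h1 : ContDiffOn ℝ ∞ (gradient (radius r)) {0}ᶜ :=
    (InnerProductSpace.toDual ℝ (E n)).symm.toContinuousLinearEquiv.contDiff.comp_contDiffOn
      (h.contDiffOn_radius.fderiv_of_isOpen isOpen_compl_singleton (by simp))
  have h2 : ContDiffOn ℝ ∞ (fun y : E n => ‖y‖⁻¹ • y) {0}ᶜ := fun y hy =>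
    (((contDiffAt_norm ℝ hy).inv (norm_ne_zero_iff.2 hy)).smul contDiffAt_id).contDiffWithinAt
  refine (h1.comp h2 fun y hy => ?_).congr fun y hy => ?_
  · exact smul_ne_zero (inv_ne_zero (norm_ne_zero_iff.2 hy)) hy
  · rw [slope, coe_proj hy, Function.comp_apply]

theorem warp_pos (h : IsProfile φ r₀ rbar r) (y : E n) : 0 < φ (radius r y) :=
  h.warping.pos _ (h.mem _) (h.pos _)

theorem d1_pos (h : IsProfile φ r₀ rbar r) (y : E n) :
    0 < d1 φ (radialInterval r₀ rbar) (radius r y) := h.warping.d1_pos _ (h.mem _)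

theorem contDiffOn_comp_radius (h : IsProfile φ r₀ rbar r) {f : ℝ → ℝ}
    (hf : ContDiffOn ℝ ∞ f (radialInterval r₀ rbar)) :
    ContDiffOn ℝ ∞ (fun y => f (radius r y)) {0}ᶜ :=
  hf.comp h.contDiffOn_radius fun _ _ => h.mem _

theorem contDiffOn_tilt (h : IsProfile φ r₀ rbar r) : ContDiffOn ℝ ∞ (tilt φ r) {0}ᶜ := by
  refine ContDiffOn.sqrt (contDiffOn_const.add ((h.contDiffOn_slope.norm_sq ℝ).div
    ((h.contDiffOn_comp_radius h.warping.smooth).pow 2) fun _ _ => ?_)) fun _ _ => ?_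
  · exact pow_ne_zero 2 (h.warp_pos _).ne'
  · positivity

theorem contDiffOn_normalRadial (h : IsProfile φ r₀ rbar r) :
    ContDiffOn ℝ ∞ (normalRadial φ r) {0}ᶜ :=
  h.contDiffOn_tilt.inv fun _ _ => (tilt_pos φ r _).ne'

theorem contDiffOn_normalSphere (h : IsProfile φ r₀ rbar r) :
    ContDiffOn ℝ ∞ (normalSphere φ r) {0}ᶜ :=
  (((((h.contDiffOn_comp_radius h.warping.smooth).pow 2).mul h.contDiffOn_tilt).inv fun _ _ =>
    (mul_pos (pow_pos (h.warp_pos _) 2) (tilt_pos φ r _)).ne').smul h.contDiffOn_slope).neg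

theorem _root_.WarpedFlow.fderiv_radius (r : S n → ℝ) (θ : S n) (a : E n) :
    fderiv ℝ (radius r) θ a = inner ℝ (slope r θ) a := by
  rw [slope, proj_coe, ← toDual_gradient]
  rfl

theorem hasFDerivAt_radius (h : IsProfile φ r₀ rbar r) (θ : S n) :
    HasFDerivAt (radius r) (innerSL ℝ (slope r θ)) (θ : E n) := by
  have h1 := ((h.contDiffOn_radius.contDiffAt (compl_zero_mem_nhds θ)).differentiableAt
    (by simp)).hasFDerivAt
  exact h1.congr_fderiv (ContinuousLinearMap.ext fun a => fderiv_radius r θ a)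

/-- A one-sided derivative of $f$ suffices: the graph may touch the slice $S(r_0)$, but the radius
never leaves the interval, so the composition is differentiable in the full sense. -/
theorem hasFDerivAt_comp_radius (h : IsProfile φ r₀ rbar r) (θ : S n) {f : ℝ → ℝ} {f' : ℝ}
    (hf : HasDerivWithinAt f f' (radialInterval r₀ rbar) (r θ)) :
    HasFDerivAt (fun y => f (radius r y)) (f' • innerSL ℝ (slope r θ)) (θ : E n) := by
  rw [← radius_coe r] at hf
  rw [← hasFDerivWithinAt_univ]
  exact hf.comp_hasFDerivWithinAt (θ : E n) (h.hasFDerivAt_radius θ).hasFDerivWithinAt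
    fun y _ => h.mem _

theorem inner_slope (h : IsProfile φ r₀ rbar r) (θ : S n) : inner ℝ (slope r θ) (θ : E n) = 0 := by
  rw [← fderiv_radius, (homogZero_radius r).fderiv_self
    (h.hasFDerivAt_radius θ).differentiableAt]

theorem inner_slope_self (h : IsProfile φ r₀ rbar r) (y : E n) : inner ℝ y (slope r y) = 0 := by
  rcases eq_or_ne y 0 with rfl | hy
  · simp
  · have h1 := h.inner_slope (proj y)
    rw [(homogZero_slope r).proj_eq hy] at h1
    rw [← norm_smul_proj y, inner_smul_left, real_inner_comm, norm_smul_proj, h1, mul_zero]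

theorem inner_normalSphere_self (h : IsProfile φ r₀ rbar r) (y : E n) :
    inner ℝ y (normalSphere φ r y) = 0 := by
  rw [normalSphere, inner_neg_right, inner_smul_right, h.inner_slope_self, mul_zero, neg_zero]

theorem norm_slope_sq (h : IsProfile φ r₀ rbar r) (y : E n) :
    ‖slope r y‖ ^ 2 = φ (radius r y) ^ 2 * (tilt φ r y ^ 2 - 1) := by
  have := (h.warp_pos y).ne'
  rw [tilt_sq]
  field_simp
  ring

theorem inner_slope_normalSphere (h : IsProfile φ r₀ rbar r) (y : E n) :
    inner ℝ (slope r y) (normalSphere φ r y) = -((tilt φ r y ^ 2 - 1) / tilt φ r y) := by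
  have := (h.warp_pos y).ne'
  have := (tilt_pos φ r y).ne'
  rw [normalSphere, inner_neg_right, inner_smul_right, real_inner_self_eq_norm_sq,
    h.norm_slope_sq]
  field_simp

theorem slope_eq (h : IsProfile φ r₀ rbar r) (y : E n) :
    slope r y = -((φ (radius r y) ^ 2 * tilt φ r y) • normalSphere φ r y) := by
  have := (mul_pos (pow_pos (h.warp_pos y) 2) (tilt_pos φ r y)).ne'
  rw [normalSphere, smul_neg, neg_neg, smul_smul, mul_inv_cancel₀ this, one_smul]

theorem normal_unit (h : IsProfile φ r₀ rbar r) (y : E n) :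
    normalRadial φ r y ^ 2 + φ (radius r y) ^ 2 * ‖normalSphere φ r y‖ ^ 2 = 1 := by
  have := (h.warp_pos y).ne'
  have := (tilt_pos φ r y).ne'
  rw [normalRadial, normalSphere, norm_neg, norm_smul, mul_pow, h.norm_slope_sq, Real.norm_eq_abs,
    sq_abs]
  field_simp
  ring

theorem differentiableAt_normalSphere (h : IsProfile φ r₀ rbar r) (θ : S n) :
    DifferentiableAt ℝ (normalSphere φ r) θ :=
  (h.contDiffOn_normalSphere.contDiffAt (compl_zero_mem_nhds θ)).differentiableAt (by simp)

theorem differentiableAt_normalRadial (h : IsProfile φ r₀ rbar r) (θ : S n) :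
    DifferentiableAt ℝ (normalRadial φ r) θ :=
  (h.contDiffOn_normalRadial.contDiffAt (compl_zero_mem_nhds θ)).differentiableAt (by simp)

/-- The covariant derivative of the unit normal is orthogonal to the normal. -/
theorem fderiv_normalRadial (h : IsProfile φ r₀ rbar r) (θ : S n) (a : E n) :
    fderiv ℝ (normalRadial φ r) θ a -
        φ (r θ) * d1 φ (radialInterval r₀ rbar) (r θ) * inner ℝ a (normalSphere φ r θ) =
      inner ℝ (slope r θ) (fderiv ℝ (normalSphere φ r) θ a +
        (d1 φ (radialInterval r₀ rbar) (r θ) / φ (r θ)) •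
          (inner ℝ (slope r θ) a • normalSphere φ r θ + normalRadial φ r θ • a)) := by
  have hφ := h.warp_pos θ
  have hv := tilt_pos φ r θ
  have h1 := ((h.differentiableAt_normalRadial θ).hasFDerivAt.pow 2).add
    (((h.hasFDerivAt_comp_radius θ (h.warping.hasDerivWithinAt (h.mem θ))).pow 2).mul
      (h.differentiableAt_normalSphere θ).hasFDerivAt.norm_sq)
  -- The normal has length one, so the derivative computed in `h1` must vanish.
  have h2 : HasFDerivAt (fun y => normalRadial φ r y ^ 2 +
      φ (radius r y) ^ 2 * ‖normalSphere φ r y‖ ^ 2) (0 : E n →L[ℝ] ℝ) (θ : E n) := by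
    simp only [h.normal_unit]
    exact hasFDerivAt_const _ _
  have h3 := congrArg (fun L => L a) (h1.unique h2)
  simp only [add_apply, smul_apply,
    ContinuousLinearMap.comp_apply, innerSL_apply_apply, zero_apply,
    smul_eq_mul, nsmul_eq_mul] at h3
  have h4 : inner ℝ (slope r θ) (fderiv ℝ (normalSphere φ r) θ a) =
      -(φ (r θ) ^ 2 * tilt φ r θ *
        inner ℝ (normalSphere φ r θ) (fderiv ℝ (normalSphere φ r) θ a)) := by
    rw [h.slope_eq, inner_neg_left, inner_smul_left, radius_coe]
    rfl
  have h5 : inner ℝ a (normalSphere φ r θ) =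
      -((φ (r θ) ^ 2 * tilt φ r θ)⁻¹ * inner ℝ (slope r θ) a) := by
    rw [normalSphere, inner_neg_right, inner_smul_right, real_inner_comm, radius_coe]
  have h6 := h.normal_unit θ
  have h7 := h.inner_slope_normalSphere θ
  rw [inner_add_right, inner_smul_right, inner_add_right, inner_smul_right, inner_smul_right,
    h4, h5, h7]
  rw [radius_coe] at h3 h6 hφ
  have hN : normalRadial φ r θ = (tilt φ r θ)⁻¹ := rfl
  have hm : ‖normalSphere φ r θ‖ ^ 2 = (1 - (tilt φ r θ)⁻¹ ^ 2) / φ (r θ) ^ 2 := by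
    rw [eq_div_iff (pow_pos hφ 2).ne', ← hN]
    linear_combination h6
  rw [hm, hN] at h3
  rw [hN]
  generalize fderiv ℝ (normalRadial φ r) θ a = D at *
  generalize inner ℝ (normalSphere φ r θ) (fderiv ℝ (normalSphere φ r) θ a) = q at *
  generalize inner ℝ (slope r θ) a = g at *
  generalize d1 φ (radialInterval r₀ rbar) (r θ) = p at *
  generalize tilt φ r θ = v at *
  generalize φ (r θ) = f at *
  push_cast at h3
  -- The differentiated unit-length identity, solved for the derivative of the radial component.
  have hD : D = -v * (f ^ 2 * q + (1 - v⁻¹ ^ 2) / f ^ 2 * (f * (p * g))) := by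
    have : D = v * (v⁻¹ * D) := by field_simp
    rw [this]
    linear_combination (v / 2) * h3
  rw [hD]
  field_simp
  ring

end IsProfile

/-! ### Geometry of a parametrized radial graph -/

theorem mvfderiv_comp_of_hasFDerivAt {F G : Type*} [NormedAddCommGroup F] [NormedSpace ℝ F]
    [NormedAddCommGroup G] [NormedSpace ℝ G] {f : S n → F} {g : F → G} {g' : F →L[ℝ] G} {x : S n}
    (hf : MDifferentiableAt (𝓡 n) 𝓘(ℝ, F) f x) (hg : HasFDerivAt g g' (f x))
    (ξ : TangentSpace (𝓡 n) x) :
    mvfderiv (𝓡 n) (fun y => g (f y)) x ξ = g' (mvfderiv (𝓡 n) f x ξ) := by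
  have h := (hg.hasMFDerivAt.comp x hf.hasMFDerivAt).mfderiv
  exact congrArg (fun L => L ξ) h

/-- The spherical component of a parametrized hypersurface, as a map to `ℝ^{n+1}`. -/
def angle (Y : S n → ℝ × S n) (x : S n) : E n := (Y x).2

namespace IsEmb

variable {r₀ : ℝ} {rbar : EReal} {r : S n → ℝ} {Y : S n → ℝ × S n}

theorem mdifferentiableAt_angle (hY : IsEmb r₀ rbar Y) (x : S n) :
    MDifferentiableAt (𝓡 n) 𝓘(ℝ, E n) (angle Y) x := by
  have : Fact (Module.finrank ℝ (E n) = n + 1) := ⟨finrank_euclideanSpace_fin⟩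
  have h1 : ContMDiff (𝓡 n) (𝓡 n) ∞ fun x => (Y x).2 := contMDiff_snd.comp hY.smooth
  have h2 : ContMDiff (𝓡 n) 𝓘(ℝ, E n) ∞ (angle Y) := (contMDiff_coe_sphere (n := n)).comp h1
  exact (h2 x).mdifferentiableAt (by simp)

theorem inner_angle (hY : IsEmb r₀ rbar Y) (x : S n) (ξ : TangentSpace (𝓡 n) x) :
    inner ℝ (angle Y x) (mvfderiv (𝓡 n) (angle Y) x ξ) = 0 := by
  have h1 := mvfderiv_comp_of_hasFDerivAt (hY.mdifferentiableAt_angle x)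
    (hasStrictFDerivAt_norm_sq (angle Y x)).hasFDerivAt ξ
  have h2 : (fun y => ‖angle Y y‖ ^ 2) = fun _ => (1 : ℝ) := by
    funext y
    simp [angle]
  rw [h2, mvfderiv_const] at h1
  simpa using h1.symm

end IsEmb

theorem radial_eq_of_range_eq_graph {Y : S n → ℝ × S n} {r : S n → ℝ}
    (hg : range Y = graph r) (x : S n) : (Y x).1 = r (Y x).2 := by
  have : Y x ∈ graph r := hg ▸ mem_range_self x
  exact this

namespace IsProfile

variable {φ : ℝ → ℝ} {r₀ : ℝ} {rbar : EReal} {r : S n → ℝ} {Y : S n → ℝ × S n}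
  {ν : S n → ℝ × E n}

theorem diff_apply (h : IsProfile φ r₀ rbar r) (hY : IsEmb r₀ rbar Y) (hg : range Y = graph r)
    (x : S n) (ξ : TangentSpace (𝓡 n) x) :
    diff Y x ξ = (inner ℝ (slope r (Y x).2) (mvfderiv (𝓡 n) (angle Y) x ξ),
      mvfderiv (𝓡 n) (angle Y) x ξ) := by
  have h1 : (fun y => incl (Y y)) = fun y => (fun z => (radius r z, z)) (angle Y y) := by
    funext y
    simp only [incl, radial_eq_of_range_eq_graph hg, angle, radius_coe]
  rw [diff, h1]
  exact mvfderiv_comp_of_hasFDerivAt (hY.mdifferentiableAt_angle x)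
    ((h.hasFDerivAt_radius (Y x).2).prodMk (hasFDerivAt_id _)) ξ

/-- On a graph the angular part of $dY$ determines the radial part, so the immersion property passes
to the angular part alone. -/
theorem injective_mvfderiv_angle (h : IsProfile φ r₀ rbar r) (hY : IsEmb r₀ rbar Y)
    (hg : range Y = graph r) (x : S n) :
    Function.Injective (mvfderiv (𝓡 n) (angle Y) x) := by
  intro ξ η hξη
  apply hY.immersion x
  rw [h.diff_apply hY hg, h.diff_apply hY hg, hξη]

theorem linearIndependent_frame (h : IsProfile φ r₀ rbar r) (hY : IsEmb r₀ rbar Y)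
    (hg : range Y = graph r) (x : S n) :
    LinearIndependent ℝ fun i => mvfderiv (𝓡 n) (angle Y) x (frame x i) := by
  have hb : LinearIndependent ℝ (frame x) := by
    have := (EuclideanSpace.basisFun (Fin n) ℝ).toBasis.linearIndependent
    rw [OrthonormalBasis.coe_toBasis] at this
    convert! this using 1
    funext i
    exact (EuclideanSpace.basisFun_apply _ _ i).symm
  exact hb.map' (mvfderiv (𝓡 n) (angle Y) x).toLinearMap
    (LinearMap.ker_eq_bot.2 (h.injective_mvfderiv_angle hY hg x))

theorem mem_orthogonal_span (θ w : E n) : w ∈ (ℝ ∙ θ)ᗮ ↔ inner ℝ θ w = 0 :=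
  Submodule.mem_orthogonal_singleton_iff_inner_right

theorem finrank_orthogonal_sphere (θ : S n) : Module.finrank ℝ (ℝ ∙ (θ : E n))ᗮ = n := by
  have : Fact (Module.finrank ℝ (E n) = n + 1) := ⟨finrank_euclideanSpace_fin⟩
  exact Submodule.finrank_orthogonal_span_singleton (coe_ne_zero θ)

/-- Dimension count: an injective linear map from an $n$-dimensional space into the $n$-dimensional
space $\theta^\perp$ is onto it. -/
theorem exists_mvfderiv_angle_eq (h : IsProfile φ r₀ rbar r) (hY : IsEmb r₀ rbar Y)
    (hg : range Y = graph r) (x : S n) {w : E n} (hw : inner ℝ ((Y x).2 : E n) w = 0) :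
    ∃ ξ, mvfderiv (𝓡 n) (angle Y) x ξ = w := by
  let L : TangentSpace (𝓡 n) x →ₗ[ℝ] E n := (mvfderiv (𝓡 n) (angle Y) x).toLinearMap
  have hle : LinearMap.range L ≤ (ℝ ∙ ((Y x).2 : E n))ᗮ := by
    rintro _ ⟨ξ, rfl⟩
    exact (mem_orthogonal_span _ _).2 (hY.inner_angle x ξ)
  have heq := Submodule.eq_of_le_of_finrank_eq hle (by
    rw [LinearMap.finrank_range_of_inj (h.injective_mvfderiv_angle hY hg x),
      finrank_orthogonal_sphere]
    exact finrank_euclideanSpace_fin)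
  have : w ∈ LinearMap.range L := heq ▸ (mem_orthogonal_span _ _).2 hw
  exact this

/-- The outer unit normal of the graph of `r`. -/
theorem normal_eq (h : IsProfile φ r₀ rbar r) (hY : IsEmb r₀ rbar Y) (hg : range Y = graph r)
    (hν : IsOuterNormal φ Y ν) (x : S n) :
    ν x = (normalRadial φ r (Y x).2, normalSphere φ r (Y x).2) := by
  set θ := (Y x).2 with hθ
  have hφ := h.warp_pos θ
  have hv := tilt_pos φ r θ
  have hY1 : φ (Y x).1 = φ (radius r θ) := by rw [radial_eq_of_range_eq_graph hg, radius_coe]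
  have hn : ∀ w : E n, inner ℝ (θ : E n) w = 0 →
      inner ℝ ((ν x).1 • slope r θ + φ (radius r θ) ^ 2 • (ν x).2) w = 0 := by
    intro w hw
    obtain ⟨ξ, rfl⟩ := h.exists_mvfderiv_angle_eq hY hg x hw
    have := hν.normal x ξ
    rw [h.diff_apply hY hg, metric, hY1] at this
    rw [inner_add_left, inner_smul_left, inner_smul_left]
    exact this
  -- By `hn` this vector is orthogonal to $\theta^\perp$, and it lies in $\theta^\perp$ itself.
  have hz : (ν x).1 • slope r θ + φ (radius r θ) ^ 2 • (ν x).2 = 0 := by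
    refine inner_self_eq_zero.1 (hn _ ?_)
    rw [inner_add_right, inner_smul_right, inner_smul_right, h.inner_slope_self,
      real_inner_comm, hν.tangent, mul_zero, mul_zero, add_zero]
  have h2 : (ν x).2 = -(((φ (radius r θ) ^ 2)⁻¹ * (ν x).1) • slope r θ) := by
    rw [eq_neg_iff_add_eq_zero, mul_smul, ← smul_right_injective (E n) (pow_pos hφ 2).ne' |>.eq_iff]
    rw [smul_add, smul_smul, mul_inv_cancel₀ (pow_pos hφ 2).ne', one_smul, smul_zero, add_comm, hz]
  have hpos : 0 < (ν x).1 := by simpa [metric] using hν.outer x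
  have h1 : (ν x).1 = (tilt φ r θ)⁻¹ := by
    have hu := hν.unit x
    rw [metric, hY1, real_inner_self_eq_norm_sq, h2, norm_neg, norm_smul, mul_pow,
      h.norm_slope_sq, Real.norm_eq_abs, sq_abs] at hu
    have hsq : ((ν x).1 * tilt φ r θ) ^ 2 = 1 ^ 2 := by
      rw [← hu.trans (one_pow 2).symm]
      field_simp
      ring
    rw [← one_div, eq_div_iff hv.ne']
    exact (pow_left_inj₀ (by positivity) zero_le_one two_ne_zero).1 hsq
  refine Prod.ext h1 ?_
  rw [h2, h1, normalSphere, mul_inv]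

/-- The mean curvature of the graph of `r`. -/
theorem meanCurvature_eq (h : IsProfile φ r₀ rbar r) (hY : IsEmb r₀ rbar Y)
    (hg : range Y = graph r) (hν : IsOuterNormal φ Y ν) (x : S n) :
    meanCurvature φ (radialInterval r₀ rbar) Y ν x =
      divg (normalSphere φ r) (Y x).2 +
        d1 φ (radialInterval r₀ rbar) (r (Y x).2) / φ (r (Y x).2) *
          (inner ℝ (slope r (Y x).2) (normalSphere φ r (Y x).2) +
            n * normalRadial φ r (Y x).2) := by
  set θ := (Y x).2 with hθ
  set κ := d1 φ (radialInterval r₀ rbar) (r θ) / φ (r θ) with hκ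
  have hφ : 0 < φ (r θ) := by simpa only [radius_coe] using h.warp_pos θ
  have hY1 : (Y x).1 = r θ := radial_eq_of_range_eq_graph hg x
  -- `K` gives the spherical component of $\bar\nabla\nu$ in the direction $(\langle\nabla
  -- r,a\rangle,a)$. By `fderiv_normalRadial` the radial component is $\langle\nabla r,Ka\rangle$,
  -- so `K` carries all of the shape operator.
  let K : E n →ₗ[ℝ] E n := (fderiv ℝ (normalSphere φ r) θ).toLinearMap +
    κ • ((innerₛₗ ℝ (slope r θ)).smulRight (normalSphere φ r θ) +
      normalRadial φ r θ • LinearMap.id)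
  -- The component along $\theta$ is normal to $N$ in $I\times_\varphi\mathbb R^{n+1}$. Removing it
  -- does not change the second fundamental form and makes the range lie in $\theta^\perp$.
  let A : E n →ₗ[ℝ] E n := K - ((innerₛₗ ℝ (θ : E n)).comp K).smulRight (θ : E n)
  let g : E n →ₗ[ℝ] E n →ₗ[ℝ] ℝ :=
    (innerₛₗ ℝ (slope r θ)).smulRight (innerₛₗ ℝ (slope r θ)) + φ (r θ) ^ 2 • innerₛₗ ℝ
  have hgab : ∀ a b, g a b = inner ℝ (slope r θ) a * inner ℝ (slope r θ) b +
      φ (r θ) ^ 2 * inner ℝ a b := fun a b => rfl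
  have hAW : ∀ v, A v ∈ (ℝ ∙ (θ : E n))ᗮ := by
    intro v
    rw [mem_orthogonal_span]
    simp [A, inner_sub_right, inner_smul_right]
  have hνeq : ν = fun y => (fun z => (normalRadial φ r z, normalSphere φ r z)) (angle Y y) :=
    funext fun y => h.normal_eq hY hg hν y
  have hdν : ∀ ξ, mvfderiv (𝓡 n) ν x ξ =
      (fderiv ℝ (normalRadial φ r) θ (mvfderiv (𝓡 n) (angle Y) x ξ),
        fderiv ℝ (normalSphere φ r) θ (mvfderiv (𝓡 n) (angle Y) x ξ)) := by
    intro ξ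
    rw [hνeq]
    exact mvfderiv_comp_of_hasFDerivAt (hY.mdifferentiableAt_angle x)
      ((h.differentiableAt_normalRadial θ).hasFDerivAt.prodMk
        (h.differentiableAt_normalSphere θ).hasFDerivAt) ξ
  have hcov : ∀ ξ, covDeriv φ (radialInterval r₀ rbar) Y ν x ξ =
      (inner ℝ (slope r θ) (K (mvfderiv (𝓡 n) (angle Y) x ξ)),
        K (mvfderiv (𝓡 n) (angle Y) x ξ)) := by
    intro ξ
    have h1 := h.fderiv_normalRadial θ (mvfderiv (𝓡 n) (angle Y) x ξ)
    rw [covDeriv, hdν, christoffel, h.diff_apply hY hg, h.normal_eq hY hg hν, hY1]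
    refine Prod.ext ?_ rfl
    rw [Prod.fst_add, ← sub_eq_add_neg]
    exact h1
  have htr : LinearMap.trace ℝ (E n) A = divg (normalSphere φ r) θ +
      κ * (inner ℝ (slope r θ) (normalSphere φ r θ) + n * normalRadial φ r θ) := by
    -- The field is constant along rays and $\nabla r\perp\theta$, so only the multiple of the
    -- identity acts on $\theta$. Subtracting this entry turns the factor $n+1$ of the trace of `K`
    -- into $n$.
    have hKθ : inner ℝ (θ : E n) (K θ) = κ * normalRadial φ r θ := by
      have h1 := (homogZero_normalSphere φ r).fderiv_self (h.differentiableAt_normalSphere θ)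
      simp [K, h1, h.inner_slope, inner_smul_right]
    have h2 : LinearMap.trace ℝ (E n) K = divg (normalSphere φ r) θ +
        κ * (inner ℝ (slope r θ) (normalSphere φ r θ) + normalRadial φ r θ * (n + 1)) := by
      simp only [K, map_add, map_smul, LinearMap.trace_smulRight, LinearMap.trace_id,
        finrank_euclideanSpace_fin]
      simp [divg]
    rw [map_sub, h2, LinearMap.trace_smulRight, LinearMap.comp_apply, innerₛₗ_apply_apply, hKθ]
    ring
  rw [← htr, meanCurvature]
  refine trace_gram_inv_mul (ℝ ∙ (θ : E n))ᗮ (finrank_orthogonal_sphere θ)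
    (fun i => mvfderiv (𝓡 n) (angle Y) x (frame x i)) (h.linearIndependent_frame hY hg x)
    (fun i => (mem_orthogonal_span _ _).2 (hY.inner_angle x _)) A hAW g ?_ _ _ ?_ ?_
  · intro w _ hw
    rw [hgab, real_inner_self_eq_norm_sq] at hw
    have h1 : φ (r θ) ^ 2 * ‖w‖ ^ 2 = 0 := by
      have h2 := mul_self_nonneg (inner ℝ (slope r θ) w)
      have h3 : 0 ≤ φ (r θ) ^ 2 * ‖w‖ ^ 2 := by positivity
      linarith
    simpa [hφ.ne'] using h1
  · intro i j
    rw [Matrix.of_apply, indMetric, metric, hY1, h.diff_apply hY hg, h.diff_apply hY hg, hgab]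
  · intro i j
    rw [Matrix.of_apply, secondFF, metric, hY1, h.diff_apply hY hg, hcov, hgab]
    have hj := hY.inner_angle x (frame x j)
    change inner ℝ (θ : E n) _ = 0 at hj
    simp [A, inner_sub_right, inner_sub_left, inner_smul_left, inner_smul_right, hj, h.inner_slope, ← hθ]

end IsProfile

/-! ### The evolution of the radius -/

theorem timeInterval_mem_nhds {T : EReal} {t : ℝ} (ht : t ∈ timeInterval T) (h0 : 0 < t) :
    timeInterval T ∈ 𝓝 t := by
  filter_upwards [lt_mem_nhds h0, continuous_coe_real_ereal.continuousAt.eventually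
    (gt_mem_nhds ht.2)] with s hs hsT using ⟨hs.le, hsT⟩

theorem Icc_subset_timeInterval {T : EReal} {s t : ℝ} (hs : s ∈ timeInterval T)
    (ht : t ∈ timeInterval T) : Icc s t ⊆ timeInterval T := fun _ hτ =>
  ⟨hs.1.trans hτ.1, (EReal.coe_le_coe_iff.2 hτ.2).trans_lt ht.2⟩

namespace IsGraphicalSolution

variable {φ : ℝ → ℝ} {r₀ : ℝ} {rbar T : EReal} {X : ℝ → S n → ℝ × S n} {ν : ℝ → S n → ℝ × E n}
  {r : ℝ → S n → ℝ}

theorem exists_eq (hX : IsGraphicalSolution φ r₀ rbar T X ν r) {t : ℝ} (ht : t ∈ timeInterval T)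
    (θ : S n) : ∃ x, X t x = (r t θ, θ) := by
  have : (r t θ, θ) ∈ graph (r t) := rfl
  rwa [← hX.graph_eq t ht] at this

theorem isProfile (hX : IsGraphicalSolution φ r₀ rbar T X ν r) (hφ : IsWarping φ r₀ rbar) {t : ℝ}
    (ht : t ∈ timeInterval T) : IsProfile φ r₀ rbar (r t) where
  warping := hφ
  smooth := by
    have h1 : ContMDiff (𝓡 n) ((𝓡 n).prod 𝓘(ℝ, ℝ)) ∞ fun θ : S n => (θ, t) :=
      contMDiff_id.prodMk contMDiff_const
    have h2 := hX.graph_smooth.comp h1.contMDiffOn (s := univ) fun θ _ => ⟨mem_univ _, ht⟩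
    exact contMDiffOn_univ.1 h2
  mem θ := by
    obtain ⟨x, hx⟩ := hX.exists_eq ht θ
    simpa only [hx] using (hX.emb t ht).mem x
  pos := hX.graph_pos t ht

theorem contDiffOn_radius (hX : IsGraphicalSolution φ r₀ rbar T X ν r) :
    ContDiffOn ℝ ∞ (fun p : E n × ℝ => radius (r p.2) p.1) ({0}ᶜ ×ˢ timeInterval T) := by
  intro p hp
  have h1 : ContMDiffAt 𝓘(ℝ, E n × ℝ) ((𝓡 n).prod 𝓘(ℝ, ℝ)) ∞
      (fun p : E n × ℝ => (proj p.1, p.2)) p :=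
    ((contMDiffAt_proj hp.1).comp p contDiff_fst.contMDiff.contMDiffAt).prodMk
      contDiff_snd.contMDiff.contMDiffAt
  refine contMDiffWithinAt_iff_contDiffWithinAt.1 ?_
  have h2 : MapsTo (fun p : E n × ℝ => (proj p.1, p.2)) ({0}ᶜ ×ˢ timeInterval T)
      (univ ×ˢ timeInterval T) := fun q hq => ⟨mem_univ _, hq.2⟩
  exact (hX.graph_smooth (proj p.1, p.2) ⟨mem_univ _, hp.2⟩).comp p h1.contMDiffWithinAt h2

theorem differentiableAt_radius (hX : IsGraphicalSolution φ r₀ rbar T X ν r) {t : ℝ}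
    (ht : t ∈ timeInterval T) (h0 : 0 < t) (θ : S n) :
    DifferentiableAt ℝ (fun p : E n × ℝ => radius (r p.2) p.1) (θ, t) :=
  (hX.contDiffOn_radius.contDiffAt
    (prod_mem_nhds (compl_zero_mem_nhds θ) (timeInterval_mem_nhds ht h0))).differentiableAt (by simp)

/-- Differentiate the graph relation along the trajectory of $x$: $f/v=\partial_t r+f\langle\nabla
r,N\rangle$ with $\langle\nabla r,N\rangle=-(v^2-1)/v$, hence $\partial_t r=fv$. Positive times make
the time derivative two-sided. -/
theorem speed_eq (hX : IsGraphicalSolution φ r₀ rbar T X ν r) (hφ : IsWarping φ r₀ rbar) {t : ℝ}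
    (ht : t ∈ timeInterval T) (h0 : 0 < t) {x : S n} {θ : S n} (hx : X t x = (r t θ, θ)) {f : ℝ}
    (hf : HasDerivWithinAt (fun s => incl (X s x)) (f • ν t x) (timeInterval T) t) :
    HasDerivAt (fun s => r s θ) (f * tilt φ (r t) θ) t := by
  have hP := hX.isProfile hφ ht
  have hν : ν t x = (normalRadial φ (r t) θ, normalSphere φ (r t) θ) := by
    rw [hP.normal_eq (hX.emb t ht) (hX.graph_eq t ht) (hX.normal t ht), hx]
  rw [hν] at hf
  have hd := hf.hasDerivAt (timeInterval_mem_nhds ht h0)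
  have hd1 : HasDerivAt (fun s => (X s x).1) (f * normalRadial φ (r t) θ) t := hd.fst
  have hd2 : HasDerivAt (fun s => ((X s x).2 : E n)) (f • normalSphere φ (r t) θ) t := hd.snd
  obtain ⟨L, hL⟩ := hX.differentiableAt_radius ht h0 θ
  have hxθ : (((X t x).2 : E n), t) = ((θ : E n), t) := by rw [hx]
  have hc1 : HasDerivAt (fun s => radius (r s) ((X s x).2 : E n))
      (L (f • normalSphere φ (r t) θ, 1)) t := by
    rw [← hxθ] at hL
    exact HasFDerivAt.comp_hasDerivAt (f := fun s => (((X s x).2 : E n), s)) t hL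
      (hd2.prodMk (hasDerivAt_id t))
  have hc2 : HasDerivAt (fun s => r s θ) (L (0, 1)) t := by
    have := hL.comp_hasDerivAt t ((hasDerivAt_const t (θ : E n)).prodMk (hasDerivAt_id t))
    simpa only [Function.comp_def, id, radius_coe] using this
  have hc3 : ∀ a, L (a, 0) = inner ℝ (slope (r t) θ) a := by
    have : HasFDerivAt (radius (r t)) _ (θ : E n) :=
      HasFDerivAt.comp (f := fun y : E n => (y, t)) (θ : E n) hL
        (hasFDerivAt_prodMk_left (θ : E n) t)
    intro a
    rw [← fderiv_radius, this.fderiv]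
    rfl
  have hc4 : HasDerivAt (fun s => (X s x).1) (L (f • normalSphere φ (r t) θ, 1)) t := by
    refine hc1.congr_of_eventuallyEq ?_
    filter_upwards [timeInterval_mem_nhds ht h0] with s hs
    rw [radius_coe, radial_eq_of_range_eq_graph (hX.graph_eq s hs)]
  have heq := hd1.unique hc4
  have hsplit : L (f • normalSphere φ (r t) θ, 1) = L (f • normalSphere φ (r t) θ, 0) + L (0, 1) := by
    rw [← map_add, Prod.mk_add_mk, add_zero, zero_add]
  rw [hsplit, hc3, inner_smul_right, hP.inner_slope_normalSphere, normalRadial] at heq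
  refine hc2.congr_deriv ?_
  have := (tilt_pos φ (r t) θ).ne'
  rw [← sub_eq_iff_eq_add'] at heq
  rw [← heq]
  field_simp
  ring

/-- The evolution equation of the radius along the flow. -/
theorem hasDerivAt_radius (hX : IsGraphicalSolution φ r₀ rbar T X ν r) (hφ : IsWarping φ r₀ rbar)
    {t : ℝ} (ht : t ∈ timeInterval T) (h0 : 0 < t) (θ : S n) :
    HasDerivAt (fun s => r s θ)
      ((n + 1) * ((tilt φ (r t) θ ^ 2 - 1) / tilt φ (r t) θ) -
        φ (r t θ) / d1 φ (radialInterval r₀ rbar) (r t θ) * divg (normalSphere φ (r t)) θ) t := by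
  have hP := hX.isProfile hφ ht
  obtain ⟨x, hx⟩ := hX.exists_eq ht θ
  refine (hX.speed_eq hφ ht h0 hx (hX.flow t ht x)).congr_deriv ?_
  rw [hP.meanCurvature_eq (hX.emb t ht) (hX.graph_eq t ht) (hX.normal t ht), support, metric,
    hP.normal_eq (hX.emb t ht) (hX.graph_eq t ht) (hX.normal t ht), hx]
  simp only [inner_zero_left, mul_zero, add_zero]
  rw [hP.inner_slope_normalSphere, normalRadial]
  have hv := (tilt_pos φ (r t) θ).ne'
  have hf := (hP.warp_pos θ).ne'
  have hd := (hP.d1_pos θ).ne'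
  rw [radius_coe] at hf hd
  field_simp
  ring

end IsGraphicalSolution

/-! ### The first variation of the weighted volume of a radial graph -/

/-- The density `(φ')^α φⁿ` of the weighted volume with respect to `dr dσ`. -/
def density (n : ℕ) (φ : ℝ → ℝ) (I : Set ℝ) (α ρ : ℝ) : ℝ := d1 φ I ρ ^ α * φ ρ ^ n

/-- The integrand of the derivative of the weighted volume along the flow, up to the
factor `α - 1`. -/
def dissipation (φ : ℝ → ℝ) (I : Set ℝ) (α : ℝ) (r : S n → ℝ) (y : E n) : ℝ :=
  d2 φ I (radius r y) * (d1 φ I (radius r y) ^ (α - 2) * φ (radius r y) ^ (n + 1) *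
    ((tilt φ r y ^ 2 - 1) / tilt φ r y))

theorem continuous_comp_coe {F : Type*} [TopologicalSpace F] {f : E n → F}
    (hf : ContinuousOn f {0}ᶜ) : Continuous fun θ : S n => f θ :=
  hf.comp_continuous continuous_subtype_val fun θ => coe_ne_zero θ

theorem integrable_sphere {f : S n → ℝ} (hf : Continuous f) :
    Integrable f (volume : Measure (E n)).toSphere :=
  hf.integrable_of_hasCompactSupport (HasCompactSupport.of_compactSpace f)

theorem continuousOn_divg {W : E n → E n} (hW : ContDiffOn ℝ 1 W {0}ᶜ) :
    ContinuousOn (divg W) {0}ᶜ := by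
  have h := hW.continuousOn_fderiv_of_isOpen isOpen_compl_singleton le_rfl
  have h1 : divg W = fun y => ∑ i, inner ℝ (EuclideanSpace.basisFun (Fin (n + 1)) ℝ i)
      (fderiv ℝ W y (EuclideanSpace.basisFun (Fin (n + 1)) ℝ i)) := funext (divg_eq_sum W)
  rw [h1]
  exact continuousOn_finsetSum _ fun i _ =>
    continuousOn_const.inner ((h.clm_apply continuousOn_const))

theorem IsWarping.continuousOn_density {φ : ℝ → ℝ} {r₀ : ℝ} {rbar : EReal}
    (h : IsWarping φ r₀ rbar) (α : ℝ) :
    ContinuousOn (density n φ (radialInterval r₀ rbar) α) (radialInterval r₀ rbar) :=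
  (h.contDiffOn_d1.continuousOn.rpow_const fun ρ hρ => Or.inl (h.d1_pos ρ hρ).ne').mul
    (h.smooth.continuousOn.pow n)

namespace IsProfile

variable {φ : ℝ → ℝ} {r₀ : ℝ} {rbar : EReal} {r : S n → ℝ}

theorem continuous_dissipation (h : IsProfile φ r₀ rbar r) (α : ℝ) :
    Continuous fun θ : S n => dissipation φ (radialInterval r₀ rbar) α r θ := by
  refine continuous_comp_coe ?_
  have hv := h.contDiffOn_tilt.continuousOn
  exact (h.contDiffOn_comp_radius h.warping.contDiffOn_d2).continuousOn.mul
    ((((h.contDiffOn_comp_radius h.warping.contDiffOn_d1).continuousOn.rpow_const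
      fun y _ => Or.inl (h.d1_pos y).ne').mul
      ((h.contDiffOn_comp_radius h.warping.smooth).continuousOn.pow (n + 1))).mul
      (((hv.pow 2).sub continuousOn_const).div hv fun y _ => (tilt_pos φ r y).ne'))

/-- The integration by parts behind the theorem: pointwise, the integrand is minus the divergence of
a tangential field minus $\alpha-1$ times the dissipation. -/
theorem integral_density_mul (h : IsProfile φ r₀ rbar r) (α : ℝ) :
    ∫ θ : S n, density n φ (radialInterval r₀ rbar) α (r θ) *
        ((n + 1) * ((tilt φ r θ ^ 2 - 1) / tilt φ r θ) -
          φ (r θ) / d1 φ (radialInterval r₀ rbar) (r θ) * divg (normalSphere φ r) θ)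
        ∂(volume : Measure (E n)).toSphere =
      -((α - 1) * ∫ θ : S n, dissipation φ (radialInterval r₀ rbar) α r θ
        ∂(volume : Measure (E n)).toSphere) := by
  set I := radialInterval r₀ rbar with hI
  -- This is the density times $\varphi/\varphi'$, the coefficient of $-\operatorname{div}N$. The
  -- derivative of the power $n+1$ cancels the term with factor $n+1$.
  let c : ℝ → ℝ := fun ρ => d1 φ I ρ ^ (α - 1) * φ ρ ^ (n + 1)
  let W : E n → E n := fun y => c (radius r y) • normalSphere φ r y
  have hc : ContDiffOn ℝ ∞ c I :=
    (h.warping.contDiffOn_d1.rpow_const_of_ne fun ρ hρ => (h.warping.d1_pos ρ hρ).ne').mul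
      (h.warping.smooth.pow (n + 1))
  have hW : ContDiffOn ℝ ∞ W {0}ᶜ := (h.contDiffOn_comp_radius hc).smul h.contDiffOn_normalSphere
  have hW1 : ContDiffOn ℝ 1 W {0}ᶜ := hW.of_le (by exact_mod_cast le_top)
  have hdiv := integral_sphere_divg_eq_zero hW1
    (fun y s hs => by simp only [W, homogZero_radius r y s hs, homogZero_normalSphere φ r y s hs])
    (fun y => by simp only [W, inner_smul_right, h.inner_normalSphere_self, mul_zero])
  have hpt : ∀ θ : S n, density n φ I α (r θ) *
      ((n + 1) * ((tilt φ r θ ^ 2 - 1) / tilt φ r θ) -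
        φ (r θ) / d1 φ I (r θ) * divg (normalSphere φ r) θ) =
      -divg W θ - (α - 1) * dissipation φ I α r θ := by
    intro θ
    have hdc := ((h.warping.hasDerivWithinAt_d1 (h.mem θ)).rpow_const (p := α - 1)
      (Or.inl (h.warping.d1_pos _ (h.mem θ)).ne')).mul
      ((h.warping.hasDerivWithinAt (h.mem θ)).pow (n + 1))
    have hcθ : HasFDerivAt (fun y => c (radius r y)) _ (θ : E n) := h.hasFDerivAt_comp_radius θ hdc
    have hp : 0 < d1 φ I (r θ) := h.warping.d1_pos _ (h.mem θ)
    have hv := (tilt_pos φ r θ).ne'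
    rw [divg_smul hcθ.differentiableAt (h.differentiableAt_normalSphere θ), hcθ.fderiv,
      smul_apply, innerSL_apply_apply, h.inner_slope_normalSphere, dissipation, radius_coe, density]
    -- All real powers of $\varphi'$ are written over the exponent $\alpha-2$, which leaves a
    -- rational identity.
    have e1 : d1 φ I (r θ) ^ α = d1 φ I (r θ) ^ (α - 2) * d1 φ I (r θ) ^ 2 := by
      rw [← Real.rpow_natCast, ← Real.rpow_add hp]
      norm_num
    have e2 : d1 φ I (r θ) ^ (α - 1) = d1 φ I (r θ) ^ (α - 2) * d1 φ I (r θ) := by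
      rw [← Real.rpow_add_one hp.ne']
      ring_nf
    have e3 : α - 1 - 1 = α - 2 := by ring
    simp only [c, e1, e2, e3, smul_eq_mul, ← hI, Pi.pow_apply, Nat.add_sub_cancel]
    push_cast
    field_simp
    ring
  simp_rw [hpt]
  have i1 : Integrable (fun θ : S n => -divg W θ) (volume : Measure (E n)).toSphere :=
    (integrable_sphere (continuous_comp_coe (continuousOn_divg hW1))).neg
  have i2 := (integrable_sphere (h.continuous_dissipation α)).const_mul (α - 1)
  rw [integral_sub i1 i2, integral_neg, hdiv, integral_const_mul, neg_zero, zero_sub]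

theorem one_le_tilt_sq (y : E n) : 1 ≤ tilt φ r y ^ 2 := by
  rw [tilt_sq]
  have : 0 ≤ ‖slope r y‖ ^ 2 / φ (radius r y) ^ 2 := by positivity
  linarith

/-- Isolates the sign: apart from $\varphi''$ every factor is nonnegative, and only $v^2-1=|\nabla
r|^2/\varphi^2$ can vanish. -/
theorem exists_dissipation_eq (h : IsProfile φ r₀ rbar r) (α : ℝ) (θ : S n) :
    ∃ q, 0 ≤ q ∧ (q = 0 → slope r θ = 0) ∧
      dissipation φ (radialInterval r₀ rbar) α r θ = d2 φ (radialInterval r₀ rbar) (r θ) * q := by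
  have hp := h.d1_pos θ
  have hf := h.warp_pos θ
  have hv := tilt_pos φ r θ
  have h1 : 0 ≤ tilt φ r θ ^ 2 - 1 := sub_nonneg.2 (one_le_tilt_sq _)
  refine ⟨_, ?_, ?_, by rw [dissipation, radius_coe]⟩
  · rw [radius_coe] at hp hf
    positivity
  · rw [← radius_coe r]
    intro h0
    have h2 : tilt φ r θ ^ 2 - 1 = 0 := by
      simpa [(Real.rpow_pos_of_pos hp _).ne', hf.ne', hv.ne'] using h0
    have h3 := h.norm_slope_sq θ
    rw [h2, mul_zero] at h3
    simpa using h3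

theorem integral_dissipation_nonneg (h : IsProfile φ r₀ rbar r) (α : ℝ) {c : ℝ}
    (hc : ∀ ρ ∈ radialInterval r₀ rbar, 0 < ρ → 0 ≤ c * d2 φ (radialInterval r₀ rbar) ρ) :
    0 ≤ c * ∫ θ : S n, dissipation φ (radialInterval r₀ rbar) α r θ
        ∂(volume : Measure (E n)).toSphere := by
  rw [← integral_const_mul]
  refine integral_nonneg fun θ => ?_
  obtain ⟨q, hq, -, he⟩ := h.exists_dissipation_eq α θ
  simp only [Pi.zero_apply, he, ← mul_assoc]
  exact mul_nonneg (hc _ (h.mem θ) (h.pos θ)) hq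

/-- A continuous nonnegative function that is nonzero somewhere on the sphere has positive integral.
-/
theorem slope_eq_zero (h : IsProfile φ r₀ rbar r) (α : ℝ) {c : ℝ}
    (hc : ∀ ρ ∈ radialInterval r₀ rbar, 0 < ρ → 0 < c * d2 φ (radialInterval r₀ rbar) ρ)
    (h0 : c * ∫ θ : S n, dissipation φ (radialInterval r₀ rbar) α r θ
        ∂(volume : Measure (E n)).toSphere = 0) (θ : S n) : slope r θ = 0 := by
  by_contra hne
  rw [← integral_const_mul] at h0
  refine absurd h0 (ne_of_gt ?_)
  refine ((h.continuous_dissipation α).const_mul c).integral_pos_of_hasCompactSupport_nonneg_nonzero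
    (HasCompactSupport.of_compactSpace _) (fun θ => ?_) (x := θ) ?_
  · obtain ⟨q, hq, -, he⟩ := h.exists_dissipation_eq α θ
    simp only [Pi.zero_apply, he, ← mul_assoc]
    exact mul_nonneg (hc _ (h.mem θ) (h.pos θ)).le hq
  · obtain ⟨q, hq, hq0, he⟩ := h.exists_dissipation_eq α θ
    rw [he, ← mul_assoc]
    exact mul_ne_zero (hc _ (h.mem θ) (h.pos θ)).ne' fun hq' => hne (hq0 hq')

/-- For $n\ge1$ the set $\mathbb R^{n+1}\setminus\{0\}$ is connected, and the extended radius has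
zero derivative there. -/
theorem eq_of_slope_eq_zero (hn : 1 ≤ n) (h : IsProfile φ r₀ rbar r)
    (hs : ∀ θ : S n, slope r θ = 0) (θ η : S n) : r θ = r η := by
  have hrank : 1 < Module.rank ℝ (E n) := by
    rw [← Module.finrank_eq_rank, finrank_euclideanSpace_fin]
    exact_mod_cast Nat.lt_succ_of_le hn
  have hconn := (isConnected_compl_singleton_of_one_lt_rank hrank (0 : E n)).isPreconnected
  have := isOpen_compl_singleton.is_const_of_fderiv_eq_zero hconn
    (h.contDiffOn_radius.differentiableOn (by simp)) (fun y hy => ?_) (coe_ne_zero θ)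
    (coe_ne_zero η)
  · rwa [radius_coe, radius_coe] at this
  · rw [← norm_smul_proj y, (homogZero_radius r).fderiv_smul (norm_pos_iff.2 hy)]
    have : fderiv ℝ (radius r) (proj y) = 0 :=
      ContinuousLinearMap.ext fun a => by rw [fderiv_radius, hs, inner_zero_left]; rfl
    rw [this, smul_zero]
    rfl

end IsProfile

/-! ### The weighted volume as an integral over the sphere -/

instance : Nonempty (S n) := ⟨proj 0⟩

theorem Icc_subset_radialInterval {r₀ M : ℝ} {rbar : EReal} (hM : M ∈ radialInterval r₀ rbar) :
    Icc r₀ M ⊆ radialInterval r₀ rbar := fun _ hρ =>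
  ⟨hρ.1, (EReal.coe_le_coe_iff.2 hρ.2).trans_lt hM.2⟩

theorem isClosed_enclosed {r : S n → ℝ} (hr : Continuous r) (r₀ : ℝ) :
    IsClosed (enclosed r₀ r) :=
  (isClosed_le continuous_const continuous_fst).inter
    (isClosed_le continuous_fst (hr.comp continuous_snd))

theorem IsWarping.nonneg {φ : ℝ → ℝ} {r₀ : ℝ} {rbar : EReal} (h : IsWarping φ r₀ rbar) {ρ : ℝ}
    (hρ : ρ ∈ radialInterval r₀ rbar) (hlt : r₀ < ρ) : 0 ≤ φ ρ :=
  (h.pos ρ hρ (h.r₀_nonneg.trans_lt hlt)).le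

namespace IsProfile

variable {φ : ℝ → ℝ} {r₀ : ℝ} {rbar : EReal} {r : S n → ℝ}

/-- The domain lies below the maximum of $r$, and on the compact interval from $r_0$ to that maximum
both $(\varphi')^\alpha$ and $\varphi^n$ are bounded. -/
theorem hasWeightedVolume (h : IsProfile φ r₀ rbar r) (α : ℝ) :
    HasWeightedVolume φ (radialInterval r₀ rbar) α (enclosed r₀ r) := by
  have hr := h.smooth.continuous
  obtain ⟨η, -, hη⟩ := isCompact_univ.exists_isMaxOn univ_nonempty hr.continuousOn
  have hmax : ∀ θ, r θ ≤ r η := fun θ => hη (mem_univ θ)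
  have hIcc := Icc_subset_radialInterval (h.mem η)
  have hsub : enclosed r₀ r ⊆ Icc r₀ (r η) ×ˢ univ := fun p hp =>
    ⟨⟨hp.1, hp.2.trans (hmax _)⟩, mem_univ _⟩
  have hcl := isClosed_enclosed hr r₀
  obtain ⟨C, hC⟩ := isCompact_Icc.exists_bound_of_continuousOn
    ((h.warping.smooth.mono hIcc).continuousOn.pow n)
  have hcont : ContinuousOn (fun ρ => d1 φ (radialInterval r₀ rbar) ρ ^ α) (Icc r₀ (r η)) :=
    (h.warping.contDiffOn_d1.continuousOn.mono hIcc).rpow_const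
      fun ρ hρ => Or.inl (h.warping.d1_pos ρ (hIcc hρ)).ne'
  obtain ⟨D, hD⟩ := isCompact_Icc.exists_bound_of_continuousOn hcont
  have hfin : volN n φ (radialInterval r₀ rbar) (enclosed r₀ r) ≠ ⊤ := by
    refine ne_top_of_le_ne_top ?_ (measure_mono hsub)
    rw [volN, Measure.prod_prod]
    refine ENNReal.mul_ne_top ?_ (measure_ne_top _ _)
    rw [withDensity_apply _ measurableSet_Icc]
    refine ne_top_of_le_ne_top (b := ENNReal.ofReal C * volume (Icc r₀ (r η))) ?_ ?_
    · exact ENNReal.mul_ne_top ENNReal.ofReal_ne_top measure_Icc_lt_top.ne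
    · rw [Measure.restrict_restrict measurableSet_Icc, inter_eq_left.2 hIcc,
        ← setLIntegral_const]
      exact setLIntegral_mono measurable_const fun ρ hρ =>
        ENNReal.ofReal_le_ofReal ((le_abs_self _).trans (hC ρ hρ))
  rw [HasWeightedVolume, IntegrableOn]
  have hcont2 : ContinuousOn (fun p : ℝ × S n => d1 φ (radialInterval r₀ rbar) p.1 ^ α)
      (enclosed r₀ r) := hcont.comp continuousOn_fst fun p hp => (hsub hp).1
  refine ⟨hcont2.aestronglyMeasurable hcl.measurableSet,
    .restrict_of_bounded (C := D) hfin.lt_top ?_⟩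
  filter_upwards [ae_restrict_mem hcl.measurableSet] with p hp using hD _ (hsub hp).1

theorem weightedVolume_eq (h : IsProfile φ r₀ rbar r) (α : ℝ) :
    weightedVolume φ (radialInterval r₀ rbar) α (enclosed r₀ r) =
      ∫ θ : S n, (∫ ρ in r₀..r θ, density n φ (radialInterval r₀ rbar) α ρ)
        ∂(volume : Measure (E n)).toSphere := by
  have hcl := (isClosed_enclosed h.smooth.continuous r₀).measurableSet
  have hint := (integrable_indicator_iff hcl).2 (h.hasWeightedVolume α)
  rw [weightedVolume, ← integral_indicator hcl]
  rw [volN] at hint ⊢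
  rw [integral_prod_symm _ hint]
  refine integral_congr_ae (Filter.Eventually.of_forall fun θ => ?_)
  beta_reduce
  have hIcc := Icc_subset_radialInterval (h.mem θ)
  have hind : (fun ρ => (enclosed r₀ r).indicator (fun p => d1 φ (radialInterval r₀ rbar) p.1 ^ α) (ρ, θ)) =
      (Icc r₀ (r θ)).indicator fun ρ => d1 φ (radialInterval r₀ rbar) ρ ^ α := by
    funext ρ
    by_cases hρ : ρ ∈ Icc r₀ (r θ)
    · rw [indicator_of_mem hρ, indicator_of_mem (show (ρ, θ) ∈ enclosed r₀ r from hρ)]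
    · rw [indicator_of_notMem hρ, indicator_of_notMem (show (ρ, θ) ∉ enclosed r₀ r from hρ)]
  have hmeas : AEMeasurable (fun ρ => ENNReal.ofReal (φ ρ ^ n))
      ((volume.restrict (radialInterval r₀ rbar)).restrict (Icc r₀ (r θ))) := by
    rw [Measure.restrict_restrict measurableSet_Icc, inter_eq_left.2 hIcc]
    exact ((((h.warping.smooth.mono hIcc).continuousOn.pow n)).aemeasurable
      measurableSet_Icc).ennreal_ofReal
  rw [hind, integral_indicator measurableSet_Icc,
    setIntegral_withDensity_eq_setIntegral_toReal_smul₀ hmeas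
      (Filter.Eventually.of_forall fun _ => ENNReal.ofReal_lt_top) _ measurableSet_Icc,
    Measure.restrict_restrict measurableSet_Icc, inter_eq_left.2 hIcc,
    intervalIntegral.integral_of_le (h.mem θ).1, integral_Icc_eq_integral_Ioc]
  refine setIntegral_congr_fun measurableSet_Ioc fun ρ hρ => ?_
  -- Passing to the half-open interval discards $r_0$, where positivity of $\varphi$ is not assumed
  -- if $r_0=0$.
  have hφ := h.warping.nonneg (hIcc ⟨hρ.1.le, hρ.2⟩) hρ.1
  simp only [ENNReal.toReal_ofReal (pow_nonneg hφ n), smul_eq_mul, density, mul_comm]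

end IsProfile

/-! ### The derivative of the weighted volume along the flow -/

/-- Clamping the argument to $[r_0,M]$ extends the density to a bounded continuous function on the
line. Its primitive has two-sided derivatives even at $r_0$, which the radius may attain. -/
theorem IsWarping.exists_primitive {φ : ℝ → ℝ} {r₀ M : ℝ} {rbar : EReal}
    (h : IsWarping φ r₀ rbar) (hM : M ∈ radialInterval r₀ rbar) (α : ℝ) :
    ∃ (F w : ℝ → ℝ) (C : ℝ), (∀ x, HasDerivAt F (w x) x) ∧ (∀ x, ‖w x‖ ≤ C) ∧ Continuous w ∧
      ∀ x ∈ Icc r₀ M, w x = density n φ (radialInterval r₀ rbar) α x ∧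
        F x = ∫ ρ in r₀..x, density n φ (radialInterval r₀ rbar) α ρ := by
  have hIcc := Icc_subset_radialInterval hM
  have hcont := (h.continuousOn_density (n := n) α).mono hIcc
  let w : ℝ → ℝ := fun x => density n φ (radialInterval r₀ rbar) α (max r₀ (min x M))
  have hmem : ∀ x, max r₀ (min x M) ∈ Icc r₀ M := fun x =>
    ⟨le_max_left _ _, max_le hM.1 (min_le_right _ _)⟩
  have hw : Continuous w :=
    hcont.comp_continuous (continuous_const.max (continuous_id.min continuous_const)) hmem
  have hweq : ∀ x ∈ Icc r₀ M, w x = density n φ (radialInterval r₀ rbar) α x := fun x hx => by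
    simp only [w, min_eq_left hx.2, max_eq_right hx.1]
  obtain ⟨C, hC⟩ := isCompact_Icc.exists_bound_of_continuousOn hcont
  refine ⟨fun x => ∫ ρ in r₀..x, w ρ, w, C, fun x => (hw.integral_hasStrictDerivAt r₀ x).hasDerivAt,
    fun x => hC _ (hmem x), hw, fun x hx => ⟨hweq x hx, ?_⟩⟩
  refine intervalIntegral.integral_congr fun ρ hρ => hweq ρ ?_
  rw [uIcc_of_le hx.1] at hρ
  exact ⟨hρ.1, hρ.2.trans hx.2⟩

namespace IsGraphicalSolution

variable {φ : ℝ → ℝ} {r₀ : ℝ} {rbar T : EReal} {X : ℝ → S n → ℝ × S n} {ν : ℝ → S n → ℝ × E n}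
  {r : ℝ → S n → ℝ}

theorem continuousOn_radius_time (hX : IsGraphicalSolution φ r₀ rbar T X ν r) (θ : S n) :
    ContinuousOn (fun t => r t θ) (timeInterval T) := by
  have h : ContinuousOn (fun t : ℝ => (θ, t)) (timeInterval T) := by fun_prop
  exact hX.graph_smooth.continuousOn.comp h fun t ht => ⟨mem_univ _, ht⟩

theorem exists_radius_le (hX : IsGraphicalSolution φ r₀ rbar T X ν r) (hφ : IsWarping φ r₀ rbar)
    {a b : ℝ} (ha : a ∈ timeInterval T) (hb : b ∈ timeInterval T) (hab : a ≤ b) :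
    ∃ M ∈ radialInterval r₀ rbar, ∀ t ∈ Icc a b, ∀ θ, r t θ ∈ Icc r₀ M := by
  have hsub := Icc_subset_timeInterval ha hb
  have hc : IsCompact ((univ : Set (S n)) ×ˢ Icc a b) := isCompact_univ.prod isCompact_Icc
  obtain ⟨p, hp, hmax⟩ := hc.exists_isMaxOn (univ_nonempty.prod (nonempty_Icc.2 hab))
    (hX.graph_smooth.continuousOn.mono (prod_mono_right hsub))
  refine ⟨r p.2 p.1, (hX.isProfile hφ (hsub hp.2)).mem _, fun t ht θ => ?_⟩
  exact ⟨((hX.isProfile hφ (hsub ht)).mem θ).1, hmax (show (θ, t) ∈ _ from ⟨mem_univ _, ht⟩)⟩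

/-- The dominating bound for differentiating under the integral. The extended radius is smooth in
$(y,t)$ at interior times, and the sphere times $[a,b]$ is compact; $a>0$ avoids the one-sided
endpoint 0. -/
theorem exists_deriv_radius_le (hX : IsGraphicalSolution φ r₀ rbar T X ν r)
    {a b : ℝ} (ha : 0 < a) (hb : b ∈ timeInterval T) :
    ∃ C, ∀ t ∈ Icc a b, ∀ θ, ‖deriv (fun s => r s θ) t‖ ≤ C := by
  have hsub : Icc a b ⊆ interior (timeInterval T) := fun t ht =>
    mem_interior_iff_mem_nhds.2 (timeInterval_mem_nhds
      (Icc_subset_timeInterval (s := 0) ⟨le_rfl, (EReal.coe_le_coe_iff.2 hb.1).trans_lt hb.2⟩ hb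
        ⟨ha.le.trans ht.1, ht.2⟩) (ha.trans_le ht.1))
  have hopen : IsOpen (({0}ᶜ : Set (E n)) ×ˢ interior (timeInterval T)) :=
    isOpen_compl_singleton.prod isOpen_interior
  have hsm := hX.contDiffOn_radius.mono (prod_mono_right (s := ({0}ᶜ : Set (E n)))
    (interior_subset (s := timeInterval T)))
  have hfd := (hsm.continuousOn_fderiv_of_isOpen hopen (by simp)).clm_apply
    (continuousOn_const (c := ((0 : E n), (1 : ℝ))))
  have hc : IsCompact (Metric.sphere (0 : E n) 1 ×ˢ Icc a b) :=
    (isCompact_sphere 0 1).prod isCompact_Icc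
  obtain ⟨C, hC⟩ := hc.exists_bound_of_continuousOn (hfd.mono (prod_mono
    (fun y hy => ne_zero_of_mem_unit_sphere ⟨y, hy⟩) hsub))
  refine ⟨C, fun t ht θ => ?_⟩
  have h1 := hC ((θ : E n), t) ⟨θ.2, ht⟩
  have hd : DifferentiableAt ℝ (fun p : E n × ℝ => radius (r p.2) p.1) ((θ : E n), t) :=
    (hsm.contDiffAt (hopen.mem_nhds (mk_mem_prod (coe_ne_zero θ) (hsub ht)))).differentiableAt (by simp)
  have h2 : HasDerivAt (fun s => r s θ)
      (fderiv ℝ (fun p : E n × ℝ => radius (r p.2) p.1) ((θ : E n), t) (0, 1)) t := by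
    have := HasFDerivAt.comp_hasDerivAt (f := fun s => ((θ : E n), s)) t hd.hasFDerivAt
      ((hasDerivAt_const t (θ : E n)).prodMk (hasDerivAt_id t))
    simpa only [Function.comp_def, radius_coe] using this
  rwa [h2.deriv]

theorem continuousOn_weightedVolume (hX : IsGraphicalSolution φ r₀ rbar T X ν r)
    (hφ : IsWarping φ r₀ rbar) (α : ℝ) {a b : ℝ} (ha : a ∈ timeInterval T)
    (hb : b ∈ timeInterval T) (hab : a ≤ b) :
    ContinuousOn (fun t => weightedVolume φ (radialInterval r₀ rbar) α (enclosed r₀ (r t)))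
      (Icc a b) := by
  have hsub := Icc_subset_timeInterval ha hb
  obtain ⟨M, hM, hle⟩ := hX.exists_radius_le hφ ha hb hab
  obtain ⟨F, w, -, hF, -, -, hw⟩ := hφ.exists_primitive (n := n) hM α
  have hFc : Continuous F := continuous_iff_continuousAt.2 fun x => (hF x).continuousAt
  obtain ⟨C, hC⟩ := isCompact_Icc.exists_bound_of_continuousOn (s := Icc r₀ M) hFc.continuousOn
  have hV : ∀ t ∈ Icc a b, weightedVolume φ (radialInterval r₀ rbar) α (enclosed r₀ (r t)) =
      ∫ θ : S n, F (r t θ) ∂(volume : Measure (E n)).toSphere := fun t ht => by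
    rw [(hX.isProfile hφ (hsub ht)).weightedVolume_eq]
    exact integral_congr_ae (Filter.Eventually.of_forall fun θ => ((hw _ (hle t ht θ)).2).symm)
  refine ContinuousOn.congr (fun t ht => ?_) hV
  refine continuousWithinAt_of_dominated (bound := fun _ => C) ?_ ?_ (integrable_const C) ?_
  · filter_upwards [self_mem_nhdsWithin] with s hs
    exact (hFc.comp (hX.isProfile hφ (hsub hs)).smooth.continuous).aestronglyMeasurable
  · filter_upwards [self_mem_nhdsWithin] with s hs
    exact Filter.Eventually.of_forall fun θ => hC _ (hle s hs θ)
  · exact Filter.Eventually.of_forall fun θ =>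
      hFc.continuousAt.comp_continuousWithinAt (((hX.continuousOn_radius_time θ).mono hsub) t ht)

theorem hasDerivAt_weightedVolume (hX : IsGraphicalSolution φ r₀ rbar T X ν r)
    (hφ : IsWarping φ r₀ rbar) (α : ℝ) {a b t : ℝ} (ha : a ∈ timeInterval T)
    (hb : b ∈ timeInterval T) (ht : t ∈ Ioo a b) :
    HasDerivAt (fun t => weightedVolume φ (radialInterval r₀ rbar) α (enclosed r₀ (r t)))
      (-((α - 1) * ∫ θ : S n, dissipation φ (radialInterval r₀ rbar) α (r t) θ
        ∂(volume : Measure (E n)).toSphere)) t := by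
  have hsub := Icc_subset_timeInterval ha hb
  have ht' : t ∈ timeInterval T := hsub (Ioo_subset_Icc_self ht)
  have h0 : 0 < t := ha.1.trans_lt ht.1
  have hP := hX.isProfile hφ ht'
  obtain ⟨M, hM, hle⟩ := hX.exists_radius_le hφ ha hb (ht.1.trans ht.2).le
  obtain ⟨F, w, C, hF, hwC, hwc, hw⟩ := hφ.exists_primitive (n := n) hM α
  have hFc : Continuous F := continuous_iff_continuousAt.2 fun x => (hF x).continuousAt
  have hV : ∀ t ∈ Icc a b, weightedVolume φ (radialInterval r₀ rbar) α (enclosed r₀ (r t)) =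
      ∫ θ : S n, F (r t θ) ∂(volume : Measure (E n)).toSphere := fun t ht => by
    rw [(hX.isProfile hφ (hsub ht)).weightedVolume_eq]
    exact integral_congr_ae (Filter.Eventually.of_forall fun θ => ((hw _ (hle t ht θ)).2).symm)
  -- As $a$ may be 0, the bound on $\partial_t r$ is taken from the midpoint onwards, at positive
  -- times.
  have hmid : a < (a + t) / 2 ∧ (a + t) / 2 < t := ⟨by linarith [ht.1], by linarith [ht.1]⟩
  obtain ⟨D, hD⟩ := hX.exists_deriv_radius_le (a := (a + t) / 2) (ha.1.trans_lt hmid.1) hb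
  have hC0 : 0 ≤ C := (norm_nonneg _).trans (hwC 0)
  have hdiff : ∀ τ ∈ Ioo ((a + t) / 2) b, ∀ θ, HasDerivAt (fun s => F (r s θ))
      (w (r τ θ) * deriv (fun s => r s θ) τ) τ := by
    intro τ hτ θ
    have h1 := hX.hasDerivAt_radius hφ (hsub ⟨(hmid.1.trans hτ.1).le, hτ.2.le⟩)
      ((ha.1.trans_lt hmid.1).trans hτ.1) θ
    exact (hF _).comp τ h1.differentiableAt.hasDerivAt
  have hder : ∀ θ, deriv (fun s => r s θ) t = _ := fun θ => (hX.hasDerivAt_radius hφ ht' h0 θ).deriv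
  have hcder : Continuous fun θ : S n => w (r t θ) * deriv (fun s => r s θ) t := by
    simp only [hder]
    have hv := continuous_comp_coe hP.contDiffOn_tilt.continuousOn
    have hdiv := continuous_comp_coe (continuousOn_divg
      (hP.contDiffOn_normalSphere.of_le (by exact_mod_cast le_top)))
    have hr := hP.smooth.continuous
    have hf : Continuous fun θ : S n => φ (r t θ) :=
      hφ.smooth.continuousOn.comp_continuous hr hP.mem
    have hd1 : Continuous fun θ : S n => d1 φ (radialInterval r₀ rbar) (r t θ) :=
      hφ.contDiffOn_d1.continuousOn.comp_continuous hr hP.mem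
    exact (hwc.comp hr).mul ((continuous_const.mul (((hv.pow 2).sub continuous_const).div hv
      fun θ => (tilt_pos φ (r t) θ).ne')).sub
      ((hf.div hd1 fun θ => (hφ.d1_pos _ (hP.mem θ)).ne').mul hdiv))
  have key := hasDerivAt_integral_of_dominated_loc_of_deriv_le
    (μ := (volume : Measure (E n)).toSphere) (F := fun s θ => F (r s θ)) (x₀ := t)
    (F' := fun s θ => w (r s θ) * deriv (fun s => r s θ) s) (bound := fun _ => C * D)
    (s := Ioo ((a + t) / 2) b) (Ioo_mem_nhds hmid.2 ht.2)
    (by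
      filter_upwards [Ioo_mem_nhds ht.1 ht.2] with s hs
      exact (hFc.comp (hX.isProfile hφ
        (hsub (Ioo_subset_Icc_self hs))).smooth.continuous).aestronglyMeasurable)
    (integrable_sphere (hFc.comp hP.smooth.continuous))
    hcder.aestronglyMeasurable
    (Filter.Eventually.of_forall fun θ s hs => by
      rw [norm_mul]
      exact mul_le_mul (hwC _) (hD s (Ioo_subset_Icc_self hs) θ) (norm_nonneg _) hC0)
    (integrable_const _) (Filter.Eventually.of_forall fun θ s hs => hdiff s hs θ)
  have h2 := key.2.congr_of_eventuallyEq (f₁ := fun t =>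
      weightedVolume φ (radialInterval r₀ rbar) α (enclosed r₀ (r t))) (by
    filter_upwards [Ioo_mem_nhds ht.1 ht.2] with s hs using hV s (Ioo_subset_Icc_self hs))
  refine h2.congr_deriv ?_
  rw [← hP.integral_density_mul]
  refine integral_congr_ae (Filter.Eventually.of_forall fun θ => ?_)
  simp only [hder, (hw _ (hle t (Ioo_subset_Icc_self ht) θ)).1]

/-- Monotonicity of the weighted volume along the flow, with its rigidity. -/
theorem antitoneOn_mul_weightedVolume (hX : IsGraphicalSolution φ r₀ rbar T X ν r)
    (hφ : IsWarping φ r₀ rbar) (α : ℝ) {c s t : ℝ} (hs : s ∈ timeInterval T)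
    (ht : t ∈ timeInterval T) (hst : s < t)
    (hc : ∀ ρ ∈ radialInterval r₀ rbar, 0 < ρ →
      0 ≤ c * (α - 1) * d2 φ (radialInterval r₀ rbar) ρ) :
    AntitoneOn (fun τ => c * weightedVolume φ (radialInterval r₀ rbar) α (enclosed r₀ (r τ)))
      (Icc s t) := by
  have hd : ∀ τ ∈ Ioo s t, HasDerivAt _ _ τ := fun τ hτ =>
    (hX.hasDerivAt_weightedVolume hφ α hs ht hτ).const_mul c
  have hsub := Icc_subset_timeInterval hs ht
  refine antitoneOn_of_deriv_nonpos (convex_Icc s t)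
    ((hX.continuousOn_weightedVolume hφ α hs ht hst.le).const_mul c) ?_ ?_
  · rw [interior_Icc]
    exact fun τ hτ => (hd τ hτ).differentiableAt.differentiableWithinAt
  · rw [interior_Icc]
    intro τ hτ
    rw [(hd τ hτ).deriv, mul_neg, ← mul_assoc, Left.neg_nonpos_iff]
    exact (hX.isProfile hφ (hsub (Ioo_subset_Icc_self hτ))).integral_dissipation_nonneg α hc

theorem isSlice_of_mul_weightedVolume_eq (hn : 1 ≤ n)
    (hX : IsGraphicalSolution φ r₀ rbar T X ν r)
    (hφ : IsWarping φ r₀ rbar) (α : ℝ) {c s t : ℝ} (hs : s ∈ timeInterval T)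
    (ht : t ∈ timeInterval T) (hst : s < t)
    (hc : ∀ ρ ∈ radialInterval r₀ rbar, 0 < ρ →
      0 < c * (α - 1) * d2 φ (radialInterval r₀ rbar) ρ)
    (heq : c * weightedVolume φ (radialInterval r₀ rbar) α (enclosed r₀ (r s)) =
      c * weightedVolume φ (radialInterval r₀ rbar) α (enclosed r₀ (r t))) :
    ∀ τ ∈ Icc s t, IsSlice (range (X τ)) := by
  have hsub := Icc_subset_timeInterval hs ht
  have hanti := hX.antitoneOn_mul_weightedVolume hφ α hs ht hst fun ρ hρ h0 => (hc ρ hρ h0).le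
  have hconst : ∀ τ ∈ Icc s t,
      c * weightedVolume φ (radialInterval r₀ rbar) α (enclosed r₀ (r τ)) =
        c * weightedVolume φ (radialInterval r₀ rbar) α (enclosed r₀ (r s)) := fun τ hτ =>
    le_antisymm (hanti (left_mem_Icc.2 hst.le) hτ hτ.1)
      (heq.le.trans (hanti hτ (right_mem_Icc.2 hst.le) hτ.2))
  have hopen : ∀ θ η : S n, EqOn (fun τ => r τ θ) (fun τ => r τ η) (Ioo s t) := by
    intro θ η τ hτ
    have hP := hX.isProfile hφ (hsub (Ioo_subset_Icc_self hτ))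
    have h1 := (hX.hasDerivAt_weightedVolume hφ α hs ht hτ).const_mul c
    have h2 : HasDerivAt (fun τ =>
        c * weightedVolume φ (radialInterval r₀ rbar) α (enclosed r₀ (r τ))) 0 τ := by
      refine (hasDerivAt_const τ
        (c * weightedVolume φ (radialInterval r₀ rbar) α (enclosed r₀ (r s)))).congr_of_eventuallyEq ?_
      filter_upwards [Ioo_mem_nhds hτ.1 hτ.2] with τ' hτ' using hconst τ' (Ioo_subset_Icc_self hτ')
    have h3 := h1.unique h2
    rw [mul_neg, neg_eq_zero, ← mul_assoc] at h3
    exact hP.eq_of_slope_eq_zero hn (hP.slope_eq_zero α hc h3) θ η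
  intro τ hτ
  -- The end times, where the volume is not differentiated, are reached by continuity of $r$ in
  -- time.
  have hτ' : ∀ θ η, r τ θ = r τ η := fun θ η =>
    (hopen θ η).of_subset_closure ((hX.continuousOn_radius_time θ).mono hsub)
      ((hX.continuousOn_radius_time η).mono hsub) Ioo_subset_Icc_self
      (closure_Ioo hst.ne).ge hτ
  refine ⟨r τ (proj 0), ?_⟩
  rw [hX.graph_eq τ (hsub hτ)]
  ext p
  simp only [graph, mem_ofPred_eq, mem_prod, mem_singleton_iff, mem_univ, and_true]
  rw [hτ' p.2 (proj 0)]

end IsGraphicalSolution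

end WarpedFlow

end

/-! ### Volume preservation, monotonicity and rigidity -/

open WarpedFlow in
theorem mainTheorem8 (n : ℕ) (hn : 1 ≤ n) (φ : ℝ → ℝ) (r₀ : ℝ) (rbar T : EReal)
    (hφ : IsWarping φ r₀ rbar)
    (X : ℝ → S n → ℝ × S n) (ν : ℝ → S n → ℝ × E n) (r : ℝ → S n → ℝ)
    (hX : IsGraphicalSolution φ r₀ rbar T X ν r) :
    (∀ α : ℝ, ∀ t ∈ timeInterval T,
      HasWeightedVolume φ (radialInterval r₀ rbar) α (enclosed r₀ (r t))) ∧
    (∀ s ∈ timeInterval T, ∀ t ∈ timeInterval T,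
      weightedVolume φ (radialInterval r₀ rbar) 1 (enclosed r₀ (r s)) =
        weightedVolume φ (radialInterval r₀ rbar) 1 (enclosed r₀ (r t))) ∧
    (∀ α : ℝ,
      (∀ ρ ∈ radialInterval r₀ rbar, 0 < ρ → d2 φ (radialInterval r₀ rbar) ρ * (α - 1) < 0) →
      (∀ s ∈ timeInterval T, ∀ t ∈ timeInterval T, s < t →
        weightedVolume φ (radialInterval r₀ rbar) α (enclosed r₀ (r s)) ≤
          weightedVolume φ (radialInterval r₀ rbar) α (enclosed r₀ (r t)) ∧
        ((∃ τ ∈ Icc s t, ¬ IsSlice (range (X τ))) →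
          weightedVolume φ (radialInterval r₀ rbar) α (enclosed r₀ (r s)) <
            weightedVolume φ (radialInterval r₀ rbar) α (enclosed r₀ (r t))))) ∧
    (∀ α : ℝ,
      (∀ ρ ∈ radialInterval r₀ rbar, 0 < ρ → 0 < d2 φ (radialInterval r₀ rbar) ρ * (α - 1)) →
      (∀ s ∈ timeInterval T, ∀ t ∈ timeInterval T, s < t →
        weightedVolume φ (radialInterval r₀ rbar) α (enclosed r₀ (r t)) ≤
          weightedVolume φ (radialInterval r₀ rbar) α (enclosed r₀ (r s)) ∧
        ((∃ τ ∈ Icc s t, ¬ IsSlice (range (X τ))) →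
          weightedVolume φ (radialInterval r₀ rbar) α (enclosed r₀ (r t)) <
            weightedVolume φ (radialInterval r₀ rbar) α (enclosed r₀ (r s))))) := by
  refine ⟨fun α t ht => (hX.isProfile hφ ht).hasWeightedVolume α, ?_, ?_, ?_⟩
  · have hle : ∀ s ∈ timeInterval T, ∀ t ∈ timeInterval T, s < t →
        weightedVolume φ (radialInterval r₀ rbar) 1 (enclosed r₀ (r s)) =
          weightedVolume φ (radialInterval r₀ rbar) 1 (enclosed r₀ (r t)) := by
      intro s hs t ht hst
      -- For $\alpha=1$ the factor $\alpha-1$ vanishes, so the sign condition holds for both $c=1$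
      -- and $c=-1$ and gives the two opposite inequalities.
      have h1 := hX.antitoneOn_mul_weightedVolume hφ 1 (c := 1) hs ht hst (by simp)
        (left_mem_Icc.2 hst.le) (right_mem_Icc.2 hst.le) hst.le
      have h2 := hX.antitoneOn_mul_weightedVolume hφ 1 (c := -1) hs ht hst (by simp)
        (left_mem_Icc.2 hst.le) (right_mem_Icc.2 hst.le) hst.le
      simp only [one_mul, neg_mul, neg_le_neg_iff] at h1 h2
      exact le_antisymm h2 h1
    intro s hs t ht
    rcases lt_trichotomy s t with h | rfl | h
    · exact hle s hs t ht h
    · rfl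
    · exact (hle t ht s hs h).symm
  · intro α hα s hs t ht hst
    -- Taking $c=-1$ turns the negative sign of $\varphi''(\alpha-1)$ into the positive one that the
    -- general statement requires.
    have hc : ∀ ρ ∈ radialInterval r₀ rbar, 0 < ρ →
        0 < -1 * (α - 1) * d2 φ (radialInterval r₀ rbar) ρ := fun ρ hρ h0 => by
      linarith [hα ρ hρ h0]
    have h1 := hX.antitoneOn_mul_weightedVolume hφ α hs ht hst (fun ρ hρ h0 => (hc ρ hρ h0).le)
      (left_mem_Icc.2 hst.le) (right_mem_Icc.2 hst.le) hst.le
    simp only [neg_mul, one_mul, neg_le_neg_iff] at h1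
    refine ⟨h1, fun ⟨τ, hτ, hne⟩ => lt_of_le_of_ne h1 fun heq => hne ?_⟩
    exact hX.isSlice_of_mul_weightedVolume_eq hn hφ α hs ht hst hc (by rw [heq]) τ hτ
  · intro α hα s hs t ht hst
    have hc : ∀ ρ ∈ radialInterval r₀ rbar, 0 < ρ →
        0 < 1 * (α - 1) * d2 φ (radialInterval r₀ rbar) ρ := fun ρ hρ h0 => by
      linarith [hα ρ hρ h0]
    have h1 := hX.antitoneOn_mul_weightedVolume hφ α hs ht hst (fun ρ hρ h0 => (hc ρ hρ h0).le)
      (left_mem_Icc.2 hst.le) (right_mem_Icc.2 hst.le) hst.le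
    simp only [one_mul] at h1
    refine ⟨h1, fun ⟨τ, hτ, hne⟩ => lt_of_le_of_ne h1 fun heq => hne ?_⟩
    exact hX.isSlice_of_mul_weightedVolume_eq hn hφ α hs ht hst hc (by rw [heq]) τ hτ
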